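/- Let $k$ be a field of characteristic $p>2$ with $[k:k^p]<\infty$, let $k[x^2,y^2,z^2,xy,xz,yz]\subset k[x,y,z]$ be the $k$-subalgebra generated by the monomials of degree two, and let $(R,\mathfrak m,k)$ be its localization at the homogeneous maximal ideal; write $d=\dim R$ and $p^{\alpha}=[k:k^p]$. For $e\ge 0$ let ${}^e\!R\,(\cong R^{1/p^e})$ denote $R$ regarded as an $R$-module through the $e$-fold Frobenius map $r\mapsto r^{p^e}$, let $a_e$ be the largest rank of a free direct summand of ${}^e\!R$, let $\mathfrak m^{[p^e]}$ be the ideal generated by all $r^{p^e}$ with $r\in\mathfrak m$, let $\lambda$ denote length, and put $\beta_i(M)=\dim_k\operatorname{Tor}^R_i(M,k)$ for a finitely generated $R$-module $M$. Then $k[x^2,y^2,z^2,xy,xz,yz]=k[x,y,z]^{\mathbb Z/2}$, where the generator of $\mathbb Z/2$ acts by $x\mapsto -x$, $y\mapsto -y$, $z\mapsto -z$, and the $F$-signature, the Hilbert-Kunz multiplicity and the Frobenius Betti numbers of $R$ exist and are $$s(R)=\lim_{e\to\infty}\frac{a_e}{p^{(\alpha+d)e}}=\frac12,\qquad e_{HK}(R)=\lim_{e\to\infty}\frac{\lambda(R/\mathfrak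 m^{[p^e]})}{p^{de}}=2,\qquad \beta_i^F(R)=\lim_{e\to\infty}\frac{\beta_i({}^e\!R)}{p^{(\alpha+d)e}}=4\cdot 3^{i-1}\quad\text{for all } i\ge 1.$$ Moreover, $R$ has a canonical module $A$ (a finitely generated $R$-module with $\dim_k\operatorname{Ext}_R^i(k,A)=1$ for $i=d$ and $0$ for $i\neq d$) such that for every $e\ge 0$ there is an integer $b_e\ge 0$ with ${}^e\!R\cong R^{a_e}\oplus A^{b_e}$, and its Betti numbers are $\beta_0(A)=3$ and $\beta_i(A)=8\cdot 3^{i-1}$ for all $i\ge 1$. -/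

import Mathlib

open CategoryTheory

universe u

noncomputable section

namespace FrobeniusBetti

/-! ### Numerical invariants of a local ring `(R, 𝔪, κ)` of prime characteristic `p` -/

section Invariants

variable (R : Type u) [CommRing R]

/-- The residue field of a local ring of prime characteristic `p` has characteristic `p`. -/
instance residueFieldCharP [IsLocalRing R] (p : ℕ) [Fact p.Prime] [CharP R p] :
    CharP (IsLocalRing.ResidueField R) p := by
  rw [CharP.charP_iff_prime_eq_zero Fact.out]
  rw [← map_natCast (IsLocalRing.residue R) p, CharP.cast_eq_zero R p, map_zero]

/-- The additive group of `R`, to be regarded as an `R`-module through the `e`-fold iterated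
Frobenius map `r ↦ r ^ p ^ e`; this is the module `ᵉR`. -/
def FrobeniusModule (_p _e : ℕ) : Type u := R

instance (p e : ℕ) : AddCommGroup (FrobeniusModule R p e) :=
  inferInstanceAs (AddCommGroup R)

/-- The action is `r • s = r ^ p ^ e * s`. -/
instance (p e : ℕ) [Fact p.Prime] [CharP R p] : Module R (FrobeniusModule R p e) :=
  Module.compHom R (iterateFrobenius R p e)

/-- The Krull dimension as a natural number (for rings of finite Krull dimension). -/
def dim : ℕ := ((ringKrullDim R).unbotD 0).toNat

/-- The largest rank of a free direct summand of the `R`-module `M`. -/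
def freeRank (M : Type u) [AddCommGroup M] [Module R M] : ℕ :=
  sSup {n : ℕ | ∃ F N : Submodule R M, IsCompl F N ∧ Nonempty (F ≃ₗ[R] (Fin n → R))}

variable [IsLocalRing R]

/-- The `i`-th Betti number `dim_κ Tor_i(M, κ)`. The module `Tor_i(M, κ)` is annihilated by the
maximal ideal, so that its dimension over `κ` is its length over `R`. -/
def betti (M : Type u) [AddCommGroup M] [Module R M] (i : ℕ) : ℕ∞ :=
  Module.length R
    (((Tor' (ModuleCat.{u} R) i).obj (ModuleCat.of R M)).obj
      (ModuleCat.of R (IsLocalRing.ResidueField R)))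

/-- `M` is a canonical module of `R`: it is finitely generated and
`dim_κ Ext^i(κ, M)` is `1` for `i = dim R` and `0` for all other `i`. -/
def IsCanonicalModule (M : Type u) [AddCommGroup M] [Module R M] : Prop :=
  Module.Finite R M ∧ ∀ i : ℕ,
    Module.length R
      (Abelian.Ext.{u} (ModuleCat.of R (IsLocalRing.ResidueField R)) (ModuleCat.of R M) i) =
        if i = dim R then 1 else 0

variable (p : ℕ) [Fact p.Prime] [CharP R p]

/-- The degree `[κ : κ ^ p]`, that is, the dimension of `κ` over itself through Frobenius. -/
def residueDegree : ℕ :=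
  Module.finrank (IsLocalRing.ResidueField R)
    (FrobeniusModule (IsLocalRing.ResidueField R) p 1)

/-- The normalizing factor `p ^ ((α + d) e)`, where `d = dim R` and `p ^ α = [κ : κ ^ p]`. -/
def normalizer (e : ℕ) : ℝ := ((residueDegree R p : ℝ) * (p : ℝ) ^ dim R) ^ e

/-- The Frobenius power `I^[p ^ e]`, generated by all `r ^ p ^ e` with `r ∈ I`. -/
def frobeniusPower (I : Ideal R) (e : ℕ) : Ideal R :=
  Ideal.span ((fun r : R => r ^ p ^ e) '' (I : Set R))

/-- The Hilbert-Kunz multiplicity of `R` exists and equals `c`. -/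
def HasHilbertKunzMultiplicity (c : ℝ) : Prop :=
  Filter.Tendsto
    (fun e : ℕ => ((Module.length R
      (R ⧸ frobeniusPower R p (IsLocalRing.maximalIdeal R) e)).toNat : ℝ) /
        (p : ℝ) ^ (dim R * e))
    Filter.atTop (nhds c)

/-- The `F`-signature of `R` exists and equals `c`. -/
def HasFSignature (c : ℝ) : Prop :=
  Filter.Tendsto
    (fun e : ℕ => (freeRank R (FrobeniusModule R p e) : ℝ) / normalizer R p e)
    Filter.atTop (nhds c)

/-- The `i`-th Frobenius Betti number of `R` exists and equals `c`. -/
def HasFrobeniusBetti (i : ℕ) (c : ℝ) : Prop :=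
  Filter.Tendsto
    (fun e : ℕ => ((betti R (FrobeniusModule R p e) i).toNat : ℝ) / normalizer R p e)
    Filter.atTop (nhds c)

end Invariants

/-! ### The second Veronese ring in three variables -/

section Veronese

open MvPolynomial

variable (k : Type u) [Field k]

/-- The `k`-algebra `k[x², y², z², xy, xz, yz]`, inside `k[x, y, z]`. -/
def veronese : Subalgebra k (MvPolynomial (Fin 3) k) :=
  Algebra.adjoin k {X 0 ^ 2, X 1 ^ 2, X 2 ^ 2, X 0 * X 1, X 0 * X 2, X 1 * X 2}

/-- The homogeneous maximal ideal: the elements without constant term. -/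
def irrelevantIdeal : Ideal (veronese k) :=
  RingHom.ker ((constantCoeff (R := k) (σ := Fin 3)).comp (veronese k).val.toRingHom)

instance : (irrelevantIdeal k).IsPrime :=
  RingHom.ker_isPrime _

/-- The local ring of `k[x², y², z², xy, xz, yz]` at its homogeneous maximal ideal. -/
def VeroneseLocal : Type u := Localization.AtPrime (irrelevantIdeal k)

instance : CommRing (VeroneseLocal k) :=
  inferInstanceAs (CommRing (Localization.AtPrime (irrelevantIdeal k)))

instance : Algebra (veronese k) (VeroneseLocal k) :=
  inferInstanceAs (Algebra (veronese k) (Localization.AtPrime (irrelevantIdeal k)))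

instance : IsLocalization.AtPrime (VeroneseLocal k) (irrelevantIdeal k) :=
  inferInstanceAs
    (IsLocalization.AtPrime (Localization.AtPrime (irrelevantIdeal k)) (irrelevantIdeal k))

instance : IsLocalRing (VeroneseLocal k) :=
  IsLocalization.AtPrime.isLocalRing (VeroneseLocal k) (irrelevantIdeal k)

instance (p : ℕ) [CharP k p] : CharP (VeroneseLocal k) p :=
  charP_of_injective_ringHom
    (((algebraMap (veronese k) (VeroneseLocal k)).comp (algebraMap k (veronese k))).injective) p

end Veronese

end FrobeniusBetti

end

open FrobeniusBetti

/-! Let `T` be `k[x,y,z]` with the elements of the Veronese ring outside the irrelevant ideal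
inverted. The sign involution grades it by ℤ/2 as `T = R ⊕ A`, with even part `R` the local Veronese
ring. The odd part `A` is the canonical module. Everything comes from two sources: the Koszul
complex of x, y, z over `T`, and a monomial basis of `T` over its q-th powers, q = p^e.

Since the variables are odd, the Koszul complex splits into two exact strands over `R`, namely 0 → R
→ A³ → R³ → A → 0 and 0 → A → R³ → A³ → R → κ → 0. From the first, the syzygy module `syz` of `A` is
A³/R·x. Covering A³ by R⁹ and removing one redundant generator gives a minimal cover R⁸ → `syz` with
kernel `syz`³. So the Betti numbers of `A` are 3, 8, 24, … (`betti_freeOdd_succ`). The two strands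
together give the Ext groups of κ with values in `A` (`isCanonicalModule_odd`); the computations
behind this are that every endomorphism of `A` is a homothety (`exists_end_eq`) and that maps into
`A` extend along the pieces of the strands (the `exists_extend_` lemmas).

If c is a basis of k over its p^e-th powers, with n^e elements where n = [k : k^p], then the
products of c with monomials of exponents below q form a basis of `T` over its q-th powers.
Frobenius preserves parity because p is odd. Hence the even part of `T`, viewed through Frobenius,
is R^a ⊕ A^b, where a and b count the even and odd basis elements (`exists_equiv_frobeniusModule`).
Here a + b = n^e q³, and a − b = n^e because an alternating sum of q signs is 1. No functional on
`A` takes a unit value, so a is the free rank (`freeRank_eq`). The Betti numbers of ᵉR are b times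
those of `A` in positive degrees. Finally, n^e times the colength of the Frobenius power of the
maximal ideal equals the zeroth Betti number a + 3b of ᵉR, so that colength is 2q³ − 1
(`length_quotient_frobeniusPower`). The three limits follow. -/

noncomputable section

namespace FrobeniusBetti

/-! ### Splicing resolutions and dimension shifting for left derived functors -/

section Splice

variable {C : Type*} [Category* C] [Abelian C]

/-- The augmentation of a projective resolution. -/
def resolutionAugmentation {K : C} (P : ProjectiveResolution K) : P.complex.X 0 ⟶ K := P.π.f 0

lemma d_comp_resolutionAugmentation {K : C} (P : ProjectiveResolution K) :
    P.complex.d 1 0 ≫ resolutionAugmentation P = 0 :=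
  P.complex_d_comp_π_f_zero

instance {K : C} (P : ProjectiveResolution K) : Epi (resolutionAugmentation P) :=
  inferInstanceAs (Epi (P.π.f 0))

lemma exact_resolutionAugmentation {K : C} (P : ProjectiveResolution K) :
    (ShortComplex.mk _ _ (d_comp_resolutionAugmentation P)).Exact :=
  P.exact₀

lemma d_comp_augmentation_comp {K F : C} (P : ProjectiveResolution K) (f : K ⟶ F) :
    P.complex.d 1 0 ≫ resolutionAugmentation P ≫ f = 0 := by
  rw [← Category.assoc, d_comp_resolutionAugmentation, Limits.zero_comp]

lemma augmentation_comp_comp {K F M : C} (P : ProjectiveResolution K) {f : K ⟶ F} {g : F ⟶ M}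
    (w : f ≫ g = 0) : (resolutionAugmentation P ≫ f) ≫ g = 0 := by
  rw [Category.assoc, w, Limits.comp_zero]

lemma exact_augmentation_comp_left {K F : C} (P : ProjectiveResolution K) (f : K ⟶ F) [Mono f] :
    (ShortComplex.mk _ _ (d_comp_augmentation_comp P f)).Exact := by
  let φ : ShortComplex.mk _ _ (d_comp_resolutionAugmentation P) ⟶
      ShortComplex.mk _ _ (d_comp_augmentation_comp P f) :=
    { τ₁ := 𝟙 _, τ₂ := 𝟙 _, τ₃ := f }
  have : Epi φ.τ₁ := inferInstanceAs (Epi (𝟙 _))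
  have : IsIso φ.τ₂ := inferInstanceAs (IsIso (𝟙 _))
  have : Mono φ.τ₃ := inferInstanceAs (Mono f)
  exact (ShortComplex.exact_iff_of_epi_of_isIso_of_mono φ).1 (exact_resolutionAugmentation P)

lemma exact_augmentation_comp_right {K F M : C} (P : ProjectiveResolution K) {f : K ⟶ F}
    {g : F ⟶ M} (w : f ≫ g = 0) (h : (ShortComplex.mk f g w).Exact) :
    (ShortComplex.mk _ _ (augmentation_comp_comp P w)).Exact := by
  let φ : ShortComplex.mk _ _ (augmentation_comp_comp P w) ⟶ ShortComplex.mk f g w :=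
    { τ₁ := resolutionAugmentation P, τ₂ := 𝟙 _, τ₃ := 𝟙 _ }
  have : Epi φ.τ₁ := inferInstanceAs (Epi (resolutionAugmentation P))
  have : IsIso φ.τ₂ := inferInstanceAs (IsIso (𝟙 _))
  have : Mono φ.τ₃ := inferInstanceAs (Mono (𝟙 _))
  exact (ShortComplex.exact_iff_of_epi_of_isIso_of_mono φ).2 h

/-- Splicing a projective resolution of the kernel `K` of an epimorphism `g : F ⟶ M` with `F`
projective gives a projective resolution of `M`. -/
def spliceResolution {K F M : C} (P : ProjectiveResolution K) (f : K ⟶ F) (g : F ⟶ M)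
    (w : f ≫ g = 0) (hS : (ShortComplex.mk f g w).ShortExact) [Projective F] :
    ProjectiveResolution M where
  complex := P.complex.augment (resolutionAugmentation P ≫ f) (d_comp_augmentation_comp P f)
  projective n := by
    cases n with
    | zero => exact (inferInstance : Projective F)
    | succ n => exact P.projective n
  π := (ChainComplex.toSingle₀Equiv _ _).symm ⟨g, augmentation_comp_comp P w⟩
  quasiIso := ⟨fun n => by
    have hf : Mono f := hS.mono_f
    have hg : Epi g := hS.epi_g
    cases n
    · rw [ChainComplex.quasiIsoAt₀_iff, ShortComplex.quasiIso_iff_of_zeros']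
      · refine (ShortComplex.exact_and_epi_g_iff_of_iso ?_).2
          ⟨exact_augmentation_comp_right P w hS.exact, hg⟩
        exact ShortComplex.isoMk (Iso.refl _) (Iso.refl _) (Iso.refl _)
          ((Category.id_comp _).trans (Category.comp_id _).symm)
          ((Category.id_comp _).trans (((ChainComplex.toSingle₀Equiv_symm_apply_f_zero
            (C := P.complex.augment (resolutionAugmentation P ≫ f)
              (d_comp_augmentation_comp P f)) g
            (augmentation_comp_comp P w)).symm).trans (Category.comp_id _).symm))
      all_goals rfl
    · rename_i n
      rw [quasiIsoAt_iff_exactAt']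
      · rw [HomologicalComplex.exactAt_iff' _ (n + 1 + 1) (n + 1) n (by simp) (by simp)]
        -- Exactness at the old degree zero survives replacing the augmentation by its composite
        -- with `f`, because `f` is a monomorphism. Higher degrees are untouched.
        cases n with
        | zero => exact exact_augmentation_comp_left P f
        | succ n => exact P.exact_succ n
      · apply ChainComplex.exactAt_succ_single_obj⟩

variable {D : Type*} [Category* D] [Abelian D]

/-- The homology of a short complex whose second map vanishes is the cokernel of the first. -/
def homologyIsoCokernel (S : ShortComplex D) (h : S.g = 0) :
    S.homology ≅ Limits.cokernel S.f :=
  S.asIsoHomologyι h ≪≫ S.opcyclesIsoCokernel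

/-- Dimension shifting for left derived functors along a short exact sequence
`0 ⟶ K ⟶ F ⟶ M ⟶ 0` with `F` projective, in case that the functor kills `K ⟶ F`. -/
def leftDerivedShiftIso [EnoughProjectives C] (G : C ⥤ D) [G.Additive] {K F M : C} (f : K ⟶ F)
    (g : F ⟶ M) (w : f ≫ g = 0) (hS : (ShortComplex.mk f g w).ShortExact) [Projective F]
    (hG : G.map f = 0) (n : ℕ) :
    (G.leftDerived (n + 1)).obj M ≅ (G.leftDerived n).obj K := by
  refine (spliceResolution (.of K) f g w hS).isoLeftDerivedObj G (n + 1) ≪≫ ?_ ≪≫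
    ((ProjectiveResolution.of K).isoLeftDerivedObj G n).symm
  let P := (G.mapHomologicalComplex (ComplexShape.down ℕ)).obj (ProjectiveResolution.of K).complex
  let Q := (G.mapHomologicalComplex (ComplexShape.down ℕ)).obj
    (spliceResolution (.of K) f g w hS).complex
  change Q.homology (n + 1) ≅ P.homology n
  refine ShortComplex.homologyMapIso (Q.isoSc' (n + 2) (n + 1) n (by simp) (by simp)) ≪≫ ?_
  -- In the lowest case the new outgoing differential is the image of a map factoring through `f`,
  -- which `G` kills. Both homologies are then cokernels of the same map. In all other degrees the
  -- two complexes agree up to the shift.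
  cases n with
  | zero =>
    refine homologyIsoCokernel _ ?_ ≪≫ (homologyIsoCokernel (P.sc' 1 0 0) ?_).symm ≪≫
      (ShortComplex.homologyMapIso (P.isoSc' 1 0 0 (by simp) (by simp))).symm
    · change G.map (resolutionAugmentation (.of K) ≫ f) = 0
      rw [G.map_comp, hG, Limits.comp_zero]
    · exact P.shape 0 0 (by simp)
  | succ n =>
    exact ShortComplex.homologyMapIso (S₁ := Q.sc' (n + 3) (n + 2) (n + 1)) (Iso.refl _) ≪≫
     (ShortComplex.homologyMapIso (P.isoSc' (n + 2) (n + 1) n (by simp) (by simp))).symm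

end Splice

/-! ### Betti numbers and minimal covers -/

section Betti

lemma shortExact_ofHom {R : Type u} [CommRing R] {X Y Z : Type u} [AddCommGroup X]
    [AddCommGroup Y] [AddCommGroup Z]
    [Module R X] [Module R Y] [Module R Z] (f : X →ₗ[R] Y) (g : Y →ₗ[R] Z)
    (hf : Function.Injective f) (hg : Function.Surjective g) (h : Function.Exact f g) :
    (ShortComplex.mk (ModuleCat.ofHom f) (ModuleCat.ofHom g)
      (by rw [← ModuleCat.ofHom_comp, h.linearMap_comp_eq_zero]; rfl)).ShortExact where
  exact := by
    rw [ShortComplex.ShortExact.moduleCat_exact_iff_function_exact]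
    exact h
  mono_f := (ModuleCat.mono_iff_injective _).2 hf
  epi_g := (ModuleCat.epi_iff_surjective _).2 hg

variable {R : Type u} [CommRing R] [IsLocalRing R]

lemma betti_congr {M N : Type u} [AddCommGroup M] [AddCommGroup N] [Module R M] [Module R N]
    (e : M ≃ₗ[R] N) (i : ℕ) : betti R M i = betti R N i :=
  LinearEquiv.length_eq (((Tor' (ModuleCat.{u} R) i).mapIso e.toModuleIso).app
    (ModuleCat.of R (IsLocalRing.ResidueField R))).toLinearEquiv

/-- Scalars from the maximal ideal move across the tensor sign and vanish on the residue field. This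
is how minimality of a cover enters the dimension shift. -/
lemma tmul_residueField_eq_zero {M N : Type u} [AddCommGroup M] [AddCommGroup N] [Module R M]
    [Module R N] (f : M →ₗ[R] N)
    (hf : ∀ m, f m ∈ IsLocalRing.maximalIdeal R • (⊤ : Submodule R N)) :
    f.rTensor (IsLocalRing.ResidueField R) = 0 := by
  refine TensorProduct.ext' fun m c => ?_
  rw [LinearMap.rTensor_tmul, LinearMap.zero_apply]
  refine Submodule.smul_induction_on (p := fun y => y ⊗ₜ[R] c = 0) (hf m) ?_ ?_
  · intro r hr n _
    rw [TensorProduct.smul_tmul, Algebra.smul_def, IsLocalRing.ResidueField.algebraMap_eq,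
      (IsLocalRing.residue_eq_zero_iff r).2 hr, zero_mul, TensorProduct.tmul_zero]
  · intro a b ha hb
    rw [TensorProduct.add_tmul, ha, hb, add_zero]

/-- The Betti numbers shift along the first step of a minimal free resolution. -/
lemma betti_succ {K F M : Type u} [AddCommGroup K] [AddCommGroup F] [AddCommGroup M]
    [Module R K] [Module R F] [Module R M] [Module.Projective R F] (f : K →ₗ[R] F)
    (g : F →ₗ[R] M) (hf : Function.Injective f) (hg : Function.Surjective g)
    (h : Function.Exact f g)
    (hm : ∀ m, f m ∈ IsLocalRing.maximalIdeal R • (⊤ : Submodule R F)) (i : ℕ) :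
    betti R M (i + 1) = betti R K i := by
  have : Projective (ModuleCat.of R F) := ModuleCat.projective_of_categoryTheory_projective _
  refine LinearEquiv.length_eq (Iso.toLinearEquiv (leftDerivedShiftIso
    ((MonoidalCategory.tensoringRight (ModuleCat.{u} R)).obj
      (ModuleCat.of R (IsLocalRing.ResidueField R))) _ _ _ (shortExact_ofHom f g hf hg h) ?_ i))
  refine ModuleCat.hom_ext (Eq.trans ?_ (tmul_residueField_eq_zero f hm))
  rfl

lemma betti_zero (M : Type u) [AddCommGroup M] [Module R M] :
    betti R M 0 = Module.length R (M ⧸ IsLocalRing.maximalIdeal R • (⊤ : Submodule R M)) := by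
  have e : ((Tor' (ModuleCat.{u} R) 0).obj (ModuleCat.of R M)).obj
      (ModuleCat.of R (IsLocalRing.ResidueField R)) ≅ ModuleCat.of R
        (TensorProduct R M (IsLocalRing.ResidueField R)) :=
    (Functor.leftDerivedZeroIsoSelf ((MonoidalCategory.tensoringRight (ModuleCat.{u} R)).obj
      (ModuleCat.of R (IsLocalRing.ResidueField R)))).app _
  have e₁ := e.toLinearEquiv
  have e₂ := TensorProduct.comm R M (IsLocalRing.ResidueField R)
  have e₃ := TensorProduct.quotTensorEquivQuotSMul M (IsLocalRing.maximalIdeal R)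
  exact LinearEquiv.length_eq ((e₁.trans e₂).trans e₃)

end Betti

/-! ### Contravariant long exact sequences for Ext of modules -/

section Ext

open Abelian

variable {R : Type u} [CommRing R]

variable (R) in
/-- `Ext^n(M, N)` for modules. -/
abbrev ModuleExt (M N : Type u) [AddCommGroup M] [AddCommGroup N] [Module R M] [Module R N]
    (n : ℕ) : Type u :=
  Abelian.Ext.{u} (ModuleCat.of R M) (ModuleCat.of R N) n

variable {X Y Z N : Type u} [AddCommGroup X] [AddCommGroup Y] [AddCommGroup Z] [AddCommGroup N]
  [Module R X] [Module R Y] [Module R Z] [Module R N]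

lemma ModuleExt.subsingleton_of_projective [Module.Projective R X] (n : ℕ) :
    Subsingleton (ModuleExt R X N (n + 1)) := by
  have : Projective (ModuleCat.of R X) := ModuleCat.projective_of_categoryTheory_projective _
  exact ⟨fun a b => by rw [Ext.eq_zero_of_projective a, Ext.eq_zero_of_projective b]⟩

/-- The identity of a finite power is the sum of its projections followed by the inclusions, so
every class is a sum of classes that factor through Ext of a single copy. -/
lemma ModuleExt.subsingleton_pi {n : ℕ} [Subsingleton (ModuleExt R X N n)] (ι : Type)
    [Fintype ι] : Subsingleton (ModuleExt R (ι → X) N n) := by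
  classical
  refine subsingleton_of_forall_eq 0 fun x => ?_
  have h : 𝟙 (ModuleCat.of R (ι → X)) = ∑ i, ModuleCat.ofHom (LinearMap.proj (R := R) i) ≫
      ModuleCat.ofHom (LinearMap.single R (fun _ : ι => X) i) := by
    refine ModuleCat.hom_ext ?_
    refine LinearMap.ext fun v => ?_
    simp only [ModuleCat.hom_sum, ModuleCat.hom_id, ModuleCat.hom_comp, ModuleCat.hom_ofHom,
      LinearMap.sum_apply, LinearMap.comp_apply, LinearMap.id_apply]
    exact (LinearMap.sum_single_apply (fun _ : ι => X) v).symm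
  rw [← Ext.mk₀_id_comp x, h, Ext.mk₀_sum, Ext.sum_comp]
  refine Finset.sum_eq_zero fun i _ => ?_
  rw [← Ext.mk₀_comp_mk₀_assoc, Subsingleton.elim (α := ModuleExt R X N n)
    ((Ext.mk₀ (ModuleCat.ofHom (LinearMap.single R (fun _ : ι => X) i))).comp x (zero_add n)) 0,
    Ext.comp_zero]

lemma ModuleExt.subsingleton_zero (H : ∀ φ : X →ₗ[R] N, φ = 0) :
    Subsingleton (ModuleExt R X N 0) := by
  refine subsingleton_of_forall_eq 0 fun x => ?_
  obtain ⟨φ, rfl⟩ := Ext.addEquiv₀.symm.surjective x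
  have : φ = 0 := ModuleCat.hom_ext (H φ.hom)
  rw [this, map_zero]

variable (f : X →ₗ[R] Y) (g : Y →ₗ[R] Z) (hf : Function.Injective f)
  (hg : Function.Surjective g) (h : Function.Exact f g)

lemma ModuleExt.subsingleton_right
    (f : X →ₗ[R] Y) (g : Y →ₗ[R] Z) (hf : Function.Injective f)
    (hg : Function.Surjective g) (h : Function.Exact f g)
    {n : ℕ} [Subsingleton (ModuleExt R Y N (n + 1))]
    [Subsingleton (ModuleExt R X N n)] : Subsingleton (ModuleExt R Z N (n + 1)) := by
  refine subsingleton_of_forall_eq 0 fun x => ?_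
  obtain ⟨y, rfl⟩ := Ext.contravariant_sequence_exact₃ (shortExact_ofHom f g hf hg h)
    (ModuleCat.of R N) x (Subsingleton.elim (α := ModuleExt R Y N (n + 1)) _ _) (add_comm 1 n)
  rw [Subsingleton.elim (α := ModuleExt R X N n) y 0, Ext.comp_zero]

/-- The left side is the connecting map Hom(X, N) → Ext¹(Z, N), whose kernel is the image of Hom(Y,
N). -/
lemma ModuleExt.extClass_comp_eq_zero_iff (φ : X →ₗ[R] N) :
    (shortExact_ofHom f g hf hg h).extClass.comp (Ext.mk₀ (ModuleCat.ofHom φ)) (add_zero 1) = 0 ↔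
      ∃ ψ : Y →ₗ[R] N, ψ ∘ₗ f = φ := by
  constructor
  · intro hr
    obtain ⟨y, hy⟩ := Ext.contravariant_sequence_exact₁ _ _ _ (add_zero 1) hr
    obtain ⟨ψ, rfl⟩ := Ext.addEquiv₀.symm.surjective y
    refine ⟨ψ.hom, ?_⟩
    have := Ext.mk₀_comp_mk₀ (ModuleCat.ofHom f) ψ
    exact congrArg ModuleCat.Hom.hom (Ext.addEquiv₀.symm.injective (this.symm.trans hy))
  · rintro ⟨ψ, rfl⟩
    exact (congrArg (fun t => (shortExact_ofHom f g hf hg h).extClass.comp t (add_zero 1))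
      (Ext.mk₀_comp_mk₀ (ModuleCat.ofHom f) (ModuleCat.ofHom ψ)).symm).trans
      ((shortExact_ofHom f g hf hg h).extClass_comp_assoc _)

lemma ModuleExt.exists_eq_extClass_comp [Subsingleton (ModuleExt R Y N 1)]
    (x : ModuleExt R Z N 1) : ∃ φ : X →ₗ[R] N, (shortExact_ofHom f g hf hg h).extClass.comp
      (Ext.mk₀ (ModuleCat.ofHom φ)) (add_zero 1) = x := by
  obtain ⟨y, rfl⟩ := Ext.contravariant_sequence_exact₃ (shortExact_ofHom f g hf hg h)
    (ModuleCat.of R N) x (Subsingleton.elim (α := ModuleExt R Y N 1) _ _) (add_zero 1)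
  obtain ⟨φ, rfl⟩ := Ext.addEquiv₀.symm.surjective y
  exact ⟨φ.hom, rfl⟩

/-- `Ext¹(Z, N)` vanishes if `Ext¹(Y, N)` does and all maps `X → N` extend to `Y`. -/
lemma ModuleExt.subsingleton_one_right
    (f : X →ₗ[R] Y) (g : Y →ₗ[R] Z) (hf : Function.Injective f)
    (hg : Function.Surjective g) (h : Function.Exact f g)
    [Subsingleton (ModuleExt R Y N 1)]
    (H : ∀ φ : X →ₗ[R] N, ∃ ψ : Y →ₗ[R] N, ψ ∘ₗ f = φ) : Subsingleton (ModuleExt R Z N 1) := by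
  refine subsingleton_of_forall_eq 0 fun x => ?_
  obtain ⟨φ, rfl⟩ := exists_eq_extClass_comp f g hf hg h x
  exact (extClass_comp_eq_zero_iff f g hf hg h φ).2 (H φ)

/-- The connecting map is an isomorphism if the middle terms vanish. -/
lemma ModuleExt.length_eq
    (f : X →ₗ[R] Y) (g : Y →ₗ[R] Z) (hf : Function.Injective f)
    (hg : Function.Surjective g) (h : Function.Exact f g)
    {n : ℕ} [Subsingleton (ModuleExt R Y N (n + 1))]
    [Subsingleton (ModuleExt R Y N n)] :
    Module.length R (ModuleExt R Z N (n + 1)) = Module.length R (ModuleExt R X N n) := by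
  let hS := shortExact_ofHom f g hf hg h
  let δ := Ext.precompOfLinear hS.extClass R (ModuleCat.of R N) (add_comm 1 n)
  refine (LinearEquiv.length_eq (LinearEquiv.ofBijective δ ⟨?_, ?_⟩)).symm
  · rw [injective_iff_map_eq_zero]
    intro x hx
    obtain ⟨y, rfl⟩ := Ext.contravariant_sequence_exact₁ hS _ x (add_comm 1 n) hx
    rw [Subsingleton.elim (α := ModuleExt R Y N n) y 0, Ext.comp_zero]
  · intro x
    exact Ext.contravariant_sequence_exact₃ hS _ x
      (Subsingleton.elim (α := ModuleExt R Y N (n + 1)) _ _) (add_comm 1 n)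

/-- If every endomorphism of `X` is a homothety and `r` is the homothety of a map extending to
`Y` exactly for `r ∈ I`, then `Ext¹(Z, X)` is `R ⧸ I`. -/
lemma ModuleExt.length_one_eq
    (f : X →ₗ[R] Y) (g : Y →ₗ[R] Z) (hf : Function.Injective f)
    (hg : Function.Surjective g) (h : Function.Exact f g)
    [Subsingleton (ModuleExt R Y X 1)] (I : Ideal R)
    (hend : ∀ φ : X →ₗ[R] X, ∃ r : R, φ = r • LinearMap.id)
    (hI : ∀ r : R, r ∈ I ↔ ∃ ψ : Y →ₗ[R] X, ψ ∘ₗ f = r • LinearMap.id) :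
    Module.length R (ModuleExt R Z X 1) = Module.length R (R ⧸ I) := by
  let hS := shortExact_ofHom f g hf hg h
  -- The generator 1 goes to the extension class itself, so `r` goes to its pushout along the
  -- homothety `r`. Surjectivity uses that homotheties are the only endomorphisms.
  let ε : R →ₗ[R] ModuleExt R Z X 1 := LinearMap.toSpanSingleton R (ModuleExt R Z X 1)
    (hS.extClass.comp (Ext.mk₀ (ModuleCat.ofHom LinearMap.id)) (add_zero 1))
  have key (r : R) : ε r = hS.extClass.comp
      (Ext.mk₀ (ModuleCat.ofHom (r • (LinearMap.id : X →ₗ[R] X)))) (add_zero 1) := by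
    have : ModuleCat.ofHom (r • (LinearMap.id : X →ₗ[R] X)) =
      r • ModuleCat.ofHom (LinearMap.id : X →ₗ[R] X) := rfl
    rw [this, Ext.mk₀_smul, Ext.comp_smul]
    rfl
  have hε : LinearMap.ker ε = I := by
    ext r
    rw [LinearMap.mem_ker, hI, key]
    exact extClass_comp_eq_zero_iff f g hf hg h _
  have hs : Function.Surjective ε := by
    intro x
    obtain ⟨φ, rfl⟩ := exists_eq_extClass_comp f g hf hg h x
    obtain ⟨r, rfl⟩ := hend φ
    exact ⟨r, key r⟩
  rw [← hε]
  exact (LinearEquiv.length_eq (ε.quotKerEquivOfSurjective hs)).symm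

end Ext

/-! ### The ℤ/2-graded cover and exactness of its Koszul complex -/

/-- A ring `T = R ⊕ A` graded by `ℤ/2`, with even part a local ring `R` and odd part `A`, together
with three odd elements that form a regular sequence and generate `A` over `R`, such that
`A * A` is the maximal ideal of `R`. -/
structure KoszulCover (R T : Type u) [CommRing R] [IsLocalRing R] [CommRing T] [Algebra R T] where
  /-- the projection to the even part -/
  even : T →ₗ[R] R
  /-- the odd regular sequence -/
  x : Fin 3 → T
  even_algebraMap (r : R) : even (algebraMap R T r) = r
  even_x (i : Fin 3) : even (x i) = 0
  exists_mul (a b : T) : even a = 0 → even b = 0 →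
    ∃ r ∈ IsLocalRing.maximalIdeal R, algebraMap R T r = a * b
  exists_eq_sum (a : T) : even a = 0 → ∃ r : Fin 3 → R, a = ∑ i, algebraMap R T (r i) * x i
  exists_eq_sum_mul (r : R) : r ∈ IsLocalRing.maximalIdeal R →
    ∃ a : Fin 3 → T, (∀ i, even (a i) = 0) ∧ algebraMap R T r = ∑ i, x i * a i
  regular_zero (t : T) : x 0 * t = 0 → t = 0
  regular_one (t : T) : x 0 ∣ x 1 * t → x 0 ∣ t
  regular_two (t a b : T) : x 2 * t = x 0 * a + x 1 * b → ∃ c d, t = x 0 * c + x 1 * d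

namespace KoszulCover

variable {R T : Type u} [CommRing R] [IsLocalRing R] [CommRing T] [Algebra R T]
  (K : KoszulCover R T)

/-- The odd part. -/
abbrev odd : Submodule R T := LinearMap.ker K.even

lemma algebraMap_injective (K : KoszulCover R T) : Function.Injective (algebraMap R T) :=
  Function.LeftInverse.injective K.even_algebraMap

lemma even_algebraMap_mul (r : R) (t : T) : K.even (algebraMap R T r * t) = r * K.even t := by
  rw [← Algebra.smul_def, map_smul, smul_eq_mul]

lemma algebraMap_even_mul {a b : T} (ha : K.even a = 0) (hb : K.even b = 0) :
    algebraMap R T (K.even (a * b)) = a * b := by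
  obtain ⟨r, -, hr⟩ := K.exists_mul a b ha hb
  rw [← hr, K.even_algebraMap]

lemma even_mul_mem {a b : T} (ha : K.even a = 0) (hb : K.even b = 0) :
    K.even (a * b) ∈ IsLocalRing.maximalIdeal R := by
  obtain ⟨r, hr, h⟩ := K.exists_mul a b ha hb
  rwa [← h, K.even_algebraMap]

/-- The even part, as an element of `T`. -/
def ev (t : T) : T := algebraMap R T (K.even t)

/-- The odd part of an element of `T`. -/
def od (t : T) : T := t - K.ev t

lemma ev_add_od (t : T) : K.ev t + K.od t = t := add_sub_cancel _ _

lemma even_od (t : T) : K.even (K.od t) = 0 := by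
  rw [od, map_sub, ev, K.even_algebraMap, sub_self]

lemma even_odd_mul_ev {a : T} (ha : K.even a = 0) (t : T) : K.even (a * K.ev t) = 0 := by
  rw [mul_comm, ev, even_algebraMap_mul, ha, mul_zero]

/-- Multiplication by an odd element interchanges the two parts. This and `od_odd_mul` split each
Koszul identity over `T` into its two strands. -/
lemma ev_odd_mul {a : T} (ha : K.even a = 0) (t : T) : K.ev (a * t) = a * K.od t := by
  conv_lhs => rw [← K.ev_add_od t, mul_add, ev, map_add, K.even_odd_mul_ev ha, zero_add,
    K.algebraMap_even_mul ha (K.even_od t)]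

lemma od_odd_mul {a : T} (ha : K.even a = 0) (t : T) : K.od (a * t) = a * K.ev t := by
  rw [od, K.ev_odd_mul ha, ← mul_sub, od, sub_sub_cancel]

lemma ev_sub (s t : T) : K.ev (s - t) = K.ev s - K.ev t := by simp [ev]

lemma od_sub (s t : T) : K.od (s - t) = K.od s - K.od t := by simp [od, ev_sub]; ring

lemma ev_algebraMap (r : R) : K.ev (algebraMap R T r) = algebraMap R T r := by
  rw [ev, K.even_algebraMap]

lemma od_of_even_eq_zero {a : T} (ha : K.even a = 0) : K.od a = a := by
  rw [od, ev, ha, map_zero, sub_zero]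

/-- Back substitution along the regular sequence: the relation puts `u 2` in the ideal of the first
two elements. Substituting this leaves a relation that determines `u 1` modulo `x 0`, and cancelling
`x 0` determines `u 0`. -/
lemma exact_dot (u : Fin 3 → T) (hu : K.x 0 * u 0 + K.x 1 * u 1 + K.x 2 * u 2 = 0) :
    ∃ v : Fin 3 → T, u 0 = K.x 1 * v 2 - K.x 2 * v 1 ∧ u 1 = K.x 2 * v 0 - K.x 0 * v 2 ∧
      u 2 = K.x 0 * v 1 - K.x 1 * v 0 := by
  obtain ⟨p, q, h2⟩ := K.regular_two (u 2) (-u 0) (-u 1) (by linear_combination hu)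
  obtain ⟨s, hs⟩ := K.regular_one (u 1 + K.x 2 * q)
    ⟨-(u 0 + K.x 2 * p), by rw [h2] at hu; linear_combination hu⟩
  have h0 := K.regular_zero (u 0 + K.x 2 * p + K.x 1 * s) (by
    rw [h2] at hu; linear_combination hu - K.x 1 * hs)
  refine ⟨![-q, p, -s], ?_, ?_, ?_⟩ <;> simp
  · linear_combination h0
  · linear_combination hs
  · linear_combination h2

/-- Two coordinates of the cross product suffice: the first relation yields `t` from `v 0`, and the
other entries of `v` are recovered after cancelling `x 0`. -/
lemma exact_cross (v : Fin 3 → T) (h2 : K.x 0 * v 1 - K.x 1 * v 0 = 0)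
    (h1 : K.x 2 * v 0 - K.x 0 * v 2 = 0) : ∃ t, ∀ i, v i = K.x i * t := by
  obtain ⟨t, ht⟩ := K.regular_one (v 0) ⟨v 1, by linear_combination -h2⟩
  refine ⟨t, fun i => ?_⟩
  rw [← sub_eq_zero]
  fin_cases i
  · simp [ht]
  · refine K.regular_zero _ ?_
    simp
    linear_combination h2 + K.x 1 * ht
  · refine K.regular_zero _ ?_
    simp
    linear_combination -h1 + K.x 2 * ht

/-- The even part of a solution over `T` involves only the odd parts of its coefficients. The next
three lemmas use the same principle for the other positions and parities. -/
lemma exact_dot_even (r : Fin 3 → R) (hr : ∑ i, algebraMap R T (r i) * K.x i = 0) :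
    ∃ v : Fin 3 → K.odd, algebraMap R T (r 0) = K.x 1 * v 2 - K.x 2 * v 1 ∧
      algebraMap R T (r 1) = K.x 2 * v 0 - K.x 0 * v 2 ∧
      algebraMap R T (r 2) = K.x 0 * v 1 - K.x 1 * v 0 := by
  rw [Fin.sum_univ_three] at hr
  obtain ⟨v, h0, h1, h2⟩ := K.exact_dot (fun i => algebraMap R T (r i)) (by linear_combination hr)
  refine ⟨fun i => ⟨K.od (v i), K.even_od _⟩, ?_, ?_, ?_⟩
  · simpa [ev_sub, ev_odd_mul, even_x, ev_algebraMap] using congrArg K.ev h0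
  · simpa [ev_sub, ev_odd_mul, even_x, ev_algebraMap] using congrArg K.ev h1
  · simpa [ev_sub, ev_odd_mul, even_x, ev_algebraMap] using congrArg K.ev h2

lemma exact_dot_odd (v : Fin 3 → K.odd) (hv : ∑ i, K.x i * v i = 0) :
    ∃ r : Fin 3 → R, v 0 = K.x 1 * algebraMap R T (r 2) - K.x 2 * algebraMap R T (r 1) ∧
      v 1 = K.x 2 * algebraMap R T (r 0) - K.x 0 * algebraMap R T (r 2) ∧
      v 2 = K.x 0 * algebraMap R T (r 1) - K.x 1 * algebraMap R T (r 0) := by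
  rw [Fin.sum_univ_three] at hv
  obtain ⟨u, h0, h1, h2⟩ := K.exact_dot (fun i => v i) hv
  have hod (i) : K.od (v i) = v i := K.od_of_even_eq_zero (v i).2
  refine ⟨fun i => K.even (u i), ?_, ?_, ?_⟩
  · simpa [od_sub, od_odd_mul, even_x, hod, ev] using congrArg K.od h0
  · simpa [od_sub, od_odd_mul, even_x, hod, ev] using congrArg K.od h1
  · simpa [od_sub, od_odd_mul, even_x, hod, ev] using congrArg K.od h2

lemma exact_cross_odd (v : Fin 3 → K.odd) (h2 : K.x 0 * v 1 - K.x 1 * v 0 = 0)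
    (h1 : K.x 2 * v 0 - K.x 0 * v 2 = 0) : ∃ r : R, ∀ i, (v i : T) = algebraMap R T r * K.x i := by
  obtain ⟨t, ht⟩ := K.exact_cross (fun i => v i) h2 h1
  refine ⟨K.even t, fun i => ?_⟩
  rw [← K.od_of_even_eq_zero (v i).2, ht i, K.od_odd_mul (K.even_x i), mul_comm, ev]

lemma exact_cross_even (r : Fin 3 → R)
    (h2 : K.x 0 * algebraMap R T (r 1) - K.x 1 * algebraMap R T (r 0) = 0)
    (h1 : K.x 2 * algebraMap R T (r 0) - K.x 0 * algebraMap R T (r 2) = 0) :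
    ∃ a : K.odd, ∀ i, algebraMap R T (r i) = K.x i * a := by
  obtain ⟨t, ht⟩ := K.exact_cross (fun i => algebraMap R T (r i)) h2 h1
  refine ⟨⟨K.od t, K.even_od t⟩, fun i => ?_⟩
  rw [← K.ev_algebraMap, ht i, K.ev_odd_mul (K.even_x i)]

/-- The generators of the odd part, as elements of the odd part. -/
def gen (i : Fin 3) : K.odd := ⟨K.x i, K.even_x i⟩

/-- Both `a * x 0` and `c * x 0` lie in `R`, so linearity may be applied to the identity (a x₀) c =
(c x₀) a. The factor `x 0` is cancelled afterwards. -/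
lemma mul_apply_comm {M : Type u} [AddCommGroup M] [Module R M] (j : M →ₗ[R] T)
    (φ : K.odd →ₗ[R] M) (a c : K.odd) : (a : T) * j (φ c) = c * j (φ a) := by
  have key : K.even (a * K.x 0) • c = K.even (c * K.x 0) • a := by
    ext
    simp only [SetLike.val_smul, Algebra.smul_def,
      K.algebraMap_even_mul a.2 (K.even_x 0), K.algebraMap_even_mul c.2 (K.even_x 0)]
    ring
  have := congrArg (fun z => j (φ z)) key
  simp only [map_smul, Algebra.smul_def, K.algebraMap_even_mul a.2 (K.even_x 0),
    K.algebraMap_even_mul c.2 (K.even_x 0)] at this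
  rw [← sub_eq_zero]
  refine K.regular_zero _ ?_
  linear_combination this

/-- The commutation rule for the first two generators shows that `x 0` divides the image of the
generator `x 0`. The quotient is the multiplier, and comparing any `a` with `x 0` shows that it
works everywhere. -/
lemma exists_apply_eq_mul {M : Type u} [AddCommGroup M] [Module R M] (j : M →ₗ[R] T)
    (φ : K.odd →ₗ[R] M) : ∃ t, ∀ a : K.odd, j (φ a) = a * t := by
  obtain ⟨t, ht⟩ := K.regular_one (j (φ (K.gen 0))) ⟨j (φ (K.gen 1)),
    K.mul_apply_comm j φ (K.gen 1) (K.gen 0)⟩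
  refine ⟨t, fun a => ?_⟩
  have h := K.mul_apply_comm j φ (K.gen 0) a
  rw [ht] at h
  change K.x 0 * _ = _ at h
  rw [← sub_eq_zero]
  refine K.regular_zero _ ?_
  linear_combination h

/-- The multiplier of an endomorphism may be replaced by its even part, since the values are odd. -/
lemma exists_end_eq (φ : K.odd →ₗ[R] K.odd) : ∃ r : R, φ = r • LinearMap.id := by
  obtain ⟨t, ht⟩ := K.exists_apply_eq_mul (Submodule.subtype _) φ
  refine ⟨K.even t, LinearMap.ext fun a => Subtype.ext ?_⟩
  change (φ a : T) = K.even t • (a : T)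
  have := ht a
  rw [← K.od_of_even_eq_zero (φ a).2]
  change (φ a : T) = _ at this
  rw [this, K.od_odd_mul a.2, ev, Algebra.smul_def, mul_comm]

/-- A functional on the odd part is multiplication by an odd element, and products of two odd
elements lie in the maximal ideal. So the odd part contributes nothing to free summands. -/
lemma dual_apply_mem (φ : K.odd →ₗ[R] R) (a : K.odd) : φ a ∈ IsLocalRing.maximalIdeal R := by
  obtain ⟨t, ht⟩ := K.exists_apply_eq_mul (Algebra.linearMap R T) φ
  have h : algebraMap R T (φ a) = a * t := ht a
  rw [← K.even_algebraMap (φ a), h, ← K.ev_add_od t, mul_add, map_add, K.even_odd_mul_ev a.2,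
    zero_add]
  exact K.even_mul_mem a.2 (K.even_od t)

lemma exists_hom_odd_pow (φ : (Fin 3 → K.odd) →ₗ[R] K.odd) :
    ∃ r : Fin 3 → R, ∀ v, φ v = ∑ i, r i • v i := by
  choose r hr using fun i => K.exists_end_eq (φ ∘ₗ LinearMap.single R (fun _ => K.odd) i)
  refine ⟨r, fun v => ?_⟩
  conv_lhs => rw [← LinearMap.sum_single_apply (fun _ : Fin 3 => K.odd) v, map_sum]
  exact Finset.sum_congr rfl fun i _ => LinearMap.congr_fun (hr i) (v i)

end KoszulCover

/-! ### The two strands of the Koszul complex as sequences of `R`-modules -/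

namespace KoszulCover

variable {R T : Type u} [CommRing R] [IsLocalRing R] [CommRing T] [Algebra R T]
  (K : KoszulCover R T)

/-- Multiplication by `x i`, from the odd to the even part. -/
def mulX (i : Fin 3) : K.odd →ₗ[R] R := K.even ∘ₗ LinearMap.mulLeft R (K.x i) ∘ₗ K.odd.subtype

lemma algebraMap_mulX (i : Fin 3) (a : K.odd) : algebraMap R T (K.mulX i a) = K.x i * a :=
  K.algebraMap_even_mul (K.even_x i) a.2

lemma mulX_mem (i : Fin 3) (a : K.odd) : K.mulX i a ∈ IsLocalRing.maximalIdeal R :=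
  K.even_mul_mem (K.even_x i) a.2

lemma coe_gen (i : Fin 3) : (K.gen i : T) = K.x i := rfl

lemma coe_smul_gen (r : R) (i : Fin 3) : ((r • K.gen i : K.odd) : T) = algebraMap R T r * K.x i :=
  Algebra.smul_def r (K.x i)

/-- The presentation `R³ → A` of the odd part. -/
def genSum : (Fin 3 → R) →ₗ[R] K.odd := Fintype.linearCombination R K.gen

lemma coe_genSum (r : Fin 3 → R) :
    (K.genSum r : T) = ∑ i, algebraMap R T (r i) * K.x i := by
  simp [genSum, Fintype.linearCombination_apply, coe_gen, Algebra.smul_def]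

lemma genSum_surjective : Function.Surjective K.genSum := fun a => by
  obtain ⟨r, hr⟩ := K.exists_eq_sum a a.2
  exact ⟨r, Subtype.ext ((K.coe_genSum r).trans hr.symm)⟩

/-- The first syzygy of the odd part. -/
abbrev syz : Submodule R (Fin 3 → R) := LinearMap.ker K.genSum

lemma mem_syz {r : Fin 3 → R} : r ∈ K.syz ↔ ∑ i, algebraMap R T (r i) * K.x i = 0 := by
  rw [LinearMap.mem_ker, ← K.coe_genSum, ZeroMemClass.coe_eq_zero]

/-- The cross product with `x` on triples of odd elements. -/
def crossOdd : (Fin 3 → K.odd) →ₗ[R] (Fin 3 → R) :=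
  LinearMap.pi ![K.mulX 1 ∘ₗ LinearMap.proj 2 - K.mulX 2 ∘ₗ LinearMap.proj 1,
    K.mulX 2 ∘ₗ LinearMap.proj 0 - K.mulX 0 ∘ₗ LinearMap.proj 2,
    K.mulX 0 ∘ₗ LinearMap.proj 1 - K.mulX 1 ∘ₗ LinearMap.proj 0]

lemma crossOdd_apply (v : Fin 3 → K.odd) : K.crossOdd v =
    ![K.mulX 1 (v 2) - K.mulX 2 (v 1), K.mulX 2 (v 0) - K.mulX 0 (v 2),
      K.mulX 0 (v 1) - K.mulX 1 (v 0)] := by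
  ext i; fin_cases i <;> rfl

lemma crossOdd_mem (v : Fin 3 → K.odd) : K.crossOdd v ∈ K.syz := by
  rw [mem_syz, crossOdd_apply, Fin.sum_univ_three]
  simp [algebraMap_mulX]
  ring

lemma exists_crossOdd_eq {r : Fin 3 → R} (hr : r ∈ K.syz) : ∃ v, K.crossOdd v = r := by
  obtain ⟨v, h0, h1, h2⟩ := K.exact_dot_even r (K.mem_syz.1 hr)
  refine ⟨v, ?_⟩
  rw [crossOdd_apply]
  ext i
  apply K.algebraMap_injective
  fin_cases i <;> simp [algebraMap_mulX, h0, h1, h2]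

/-- Each entry of a syzygy is a difference of products of two odd elements. This says that the cover
`genSum` is minimal. -/
lemma syz_apply_mem {r : Fin 3 → R} (hr : r ∈ K.syz) (i : Fin 3) :
    r i ∈ IsLocalRing.maximalIdeal R := by
  obtain ⟨v, rfl⟩ := K.exists_crossOdd_eq hr
  rw [crossOdd_apply]
  fin_cases i <;> exact sub_mem (K.mulX_mem _ _) (K.mulX_mem _ _)

/-- The map `r ↦ r x`. -/
def scaleEven : R →ₗ[R] (Fin 3 → K.odd) :=
  LinearMap.pi fun i => LinearMap.toSpanSingleton R K.odd (K.gen i)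

lemma coe_scaleEven (r : R) (i : Fin 3) : (K.scaleEven r i : T) = algebraMap R T r * K.x i :=
  K.coe_smul_gen r i

lemma scaleEven_injective : Function.Injective K.scaleEven := by
  rw [injective_iff_map_eq_zero]
  intro r hr
  apply K.algebraMap_injective
  rw [map_zero]
  apply K.regular_zero
  rw [mul_comm, ← K.coe_scaleEven, hr]
  rfl

lemma exact_scaleEven_crossOdd : Function.Exact K.scaleEven K.crossOdd := by
  intro v
  constructor
  · intro h
    rw [crossOdd_apply] at h
    have h2 := congrArg (algebraMap R T) (congrFun h 2)
    have h1 := congrArg (algebraMap R T) (congrFun h 1)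
    simp [algebraMap_mulX] at h1 h2
    obtain ⟨r, hr⟩ := K.exact_cross_odd v h2 h1
    exact ⟨r, funext fun i => Subtype.ext ((K.coe_scaleEven r i).trans (hr i).symm)⟩
  · rintro ⟨r, rfl⟩
    rw [crossOdd_apply]
    ext i
    apply K.algebraMap_injective
    fin_cases i <;> simp [algebraMap_mulX, coe_scaleEven] <;> ring

/-- The map `a ↦ a x`. -/
def scaleOdd : K.odd →ₗ[R] (Fin 3 → R) := LinearMap.pi K.mulX

lemma scaleOdd_injective : Function.Injective K.scaleOdd := by
  rw [injective_iff_map_eq_zero]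
  intro a ha
  ext
  apply K.regular_zero
  rw [← K.algebraMap_mulX]
  exact (congrArg (algebraMap R T) (congrFun ha 0)).trans (map_zero _)

/-- The cross product with `x` on triples of even elements. -/
def crossEven : (Fin 3 → R) →ₗ[R] (Fin 3 → K.odd) :=
  let s (i : Fin 3) := LinearMap.toSpanSingleton R K.odd (K.gen i)
  LinearMap.pi ![s 1 ∘ₗ LinearMap.proj 2 - s 2 ∘ₗ LinearMap.proj 1,
    s 2 ∘ₗ LinearMap.proj 0 - s 0 ∘ₗ LinearMap.proj 2,
    s 0 ∘ₗ LinearMap.proj 1 - s 1 ∘ₗ LinearMap.proj 0]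

lemma crossEven_apply (w : Fin 3 → R) : K.crossEven w =
    ![w 2 • K.gen 1 - w 1 • K.gen 2, w 0 • K.gen 2 - w 2 • K.gen 0,
      w 1 • K.gen 0 - w 0 • K.gen 1] := by
  ext i; fin_cases i <;> rfl

lemma exact_scaleOdd_crossEven : Function.Exact K.scaleOdd K.crossEven := by
  intro w
  constructor
  · intro h
    rw [crossEven_apply] at h
    have h2 := congrArg Subtype.val (congrFun h 2)
    have h1 := congrArg Subtype.val (congrFun h 1)
    simp [coe_gen, Algebra.smul_def] at h1 h2
    obtain ⟨a, ha⟩ := K.exact_cross_even w (by linear_combination h2) (by linear_combination h1)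
    exact ⟨a, funext fun i => K.algebraMap_injective
      ((K.algebraMap_mulX i a).trans (ha i).symm)⟩
  · rintro ⟨a, rfl⟩
    rw [crossEven_apply]
    ext i
    fin_cases i <;> simp [coe_gen, Algebra.smul_def, scaleOdd, algebraMap_mulX] <;> ring

/-- The dot product with `x` on triples of odd elements. -/
def dot : (Fin 3 → K.odd) →ₗ[R] R := ∑ i, K.mulX i ∘ₗ LinearMap.proj i

lemma dot_apply (v : Fin 3 → K.odd) : K.dot v = ∑ i, K.mulX i (v i) := by simp [dot]

lemma algebraMap_dot (v : Fin 3 → K.odd) : algebraMap R T (K.dot v) = ∑ i, K.x i * v i := by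
  simp [dot_apply, algebraMap_mulX]

lemma range_dot : LinearMap.range K.dot = IsLocalRing.maximalIdeal R := by
  apply le_antisymm
  · rintro _ ⟨v, rfl⟩
    rw [dot_apply]
    exact sum_mem fun i _ => K.mulX_mem _ _
  · intro r hr
    obtain ⟨a, ha, h⟩ := K.exists_eq_sum_mul r hr
    exact ⟨fun i => ⟨a i, ha i⟩, K.algebraMap_injective ((K.algebraMap_dot _).trans h.symm)⟩

lemma exact_crossEven_dot : Function.Exact K.crossEven K.dot := by
  intro v
  constructor
  · intro h
    have h' := congrArg (algebraMap R T) h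
    rw [algebraMap_dot, map_zero] at h'
    obtain ⟨r, h0, h1, h2⟩ := K.exact_dot_odd v h'
    refine ⟨r, ?_⟩
    rw [crossEven_apply]
    ext i
    fin_cases i <;> simp [coe_gen, Algebra.smul_def]
    · rw [h0]; ring
    · rw [h1]; ring
    · rw [h2]; ring
  · rintro ⟨w, rfl⟩
    apply K.algebraMap_injective
    rw [algebraMap_dot, Fin.sum_univ_three, crossEven_apply]
    simp [coe_gen, Algebra.smul_def]
    ring

section Betti

variable {M F : Type u} [AddCommGroup M] [AddCommGroup F] [Module R M] [Module R F]

end Betti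

end KoszulCover

/-! ### Extending maps into the odd part, and the Ext groups of a canonical module -/

namespace KoszulCover

variable {R T : Type u} [CommRing R] [IsLocalRing R] [CommRing T] [Algebra R T]
  (K : KoszulCover R T)

/-- The cross product of `x` with triples of odd elements, as a map onto the syzygies of `A`. -/
def toSyz : (Fin 3 → K.odd) →ₗ[R] K.syz := K.crossOdd.codRestrict K.syz K.crossOdd_mem

lemma toSyz_surjective : Function.Surjective K.toSyz := fun r => by
  obtain ⟨v, hv⟩ := K.exists_crossOdd_eq r.2
  exact ⟨v, Subtype.ext hv⟩

lemma exact_scaleEven_toSyz : Function.Exact K.scaleEven K.toSyz := fun v => by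
  rw [← K.exact_scaleEven_crossOdd v, Subtype.ext_iff]
  rfl

/-- The kernel of the map `A³ → R` given by `x`. -/
abbrev cosyz : Submodule R (Fin 3 → K.odd) := LinearMap.ker K.dot

/-- The cross product of `x` with triples of even elements, as a map onto `cosyz`. -/
def toCosyz : (Fin 3 → R) →ₗ[R] K.cosyz :=
  K.crossEven.codRestrict K.cosyz fun w => K.exact_crossEven_dot.apply_apply_eq_zero w

lemma coe_toCosyz (w : Fin 3 → R) : (K.toCosyz w : Fin 3 → K.odd) = K.crossEven w := rfl

lemma toCosyz_surjective : Function.Surjective K.toCosyz := fun v => by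
  obtain ⟨w, hw⟩ := (K.exact_crossEven_dot v).1 v.2
  exact ⟨w, Subtype.ext hw⟩

lemma exact_scaleOdd_toCosyz : Function.Exact K.scaleOdd K.toCosyz := fun v => by
  rw [← K.exact_scaleOdd_crossEven v, Subtype.ext_iff]
  rfl

/-- The map from `A³` onto the maximal ideal given by `x`. -/
def toMaximalIdeal : (Fin 3 → K.odd) →ₗ[R] IsLocalRing.maximalIdeal R :=
  K.dot.codRestrict _ fun v => K.range_dot ▸ LinearMap.mem_range_self K.dot v

lemma toMaximalIdeal_surjective : Function.Surjective K.toMaximalIdeal := fun r => by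
  have hr : (r : R) ∈ LinearMap.range K.dot := by
    rw [K.range_dot]
    exact r.2
  obtain ⟨v, hv⟩ := hr
  exact ⟨v, Subtype.ext hv⟩

lemma exact_cosyz_toMaximalIdeal : Function.Exact K.cosyz.subtype K.toMaximalIdeal := fun v => by
  rw [← LinearMap.exact_subtype_ker_map K.dot v, Subtype.ext_iff]
  rfl

variable (R) in
lemma exact_maximalIdeal_residue : Function.Exact
    (IsLocalRing.maximalIdeal R).subtype (Algebra.linearMap R (IsLocalRing.ResidueField R)) :=
  fun r => by
    rw [Algebra.linearMap_apply, IsLocalRing.ResidueField.algebraMap_eq,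
      IsLocalRing.residue_eq_zero_iff]
    simp

section Extend

/-- Every map from `syz` to the odd part extends to `R³`. -/
lemma exists_extend_syz (φ : K.syz →ₗ[R] K.odd) :
    ∃ ψ : (Fin 3 → R) →ₗ[R] K.odd, ψ ∘ₗ K.syz.subtype = φ := by
  -- Pulled back to triples of odd elements, the map is a dot product with some `r` in R³. It kills
  -- `x`, so `r` is a syzygy and hence a cross product of `x` with an odd triple `a`.
  obtain ⟨r, hr⟩ := K.exists_hom_odd_pow (φ ∘ₗ K.toSyz)
  have hr' : r ∈ K.syz := by
    have h := hr (K.scaleEven 1)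
    rw [LinearMap.comp_apply, K.exact_scaleEven_toSyz.apply_apply_eq_zero, map_zero] at h
    rw [mem_syz]
    have h' := congrArg Subtype.val h.symm
    simpa [coe_scaleEven, Algebra.smul_def] using h'
  obtain ⟨a, ha⟩ := K.exists_crossOdd_eq hr'
  -- The sign is that of the triple product: (x × a)·v = −a·(x × v).
  refine ⟨-Fintype.linearCombination R a, LinearMap.ext fun s => ?_⟩
  obtain ⟨v, rfl⟩ := K.toSyz_surjective s
  have h := hr v
  rw [LinearMap.comp_apply] at h
  rw [h]
  ext
  rw [← ha, crossOdd_apply]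
  simp [Fintype.linearCombination_apply, toSyz, crossOdd_apply, Fin.sum_univ_three,
    Algebra.smul_def, algebraMap_mulX]
  ring

/-- The value at 1 is a combination of the generators, and its coefficients give the extension. -/
lemma exists_extend_scaleEven (φ : R →ₗ[R] K.odd) :
    ∃ ψ : (Fin 3 → K.odd) →ₗ[R] K.odd, ψ ∘ₗ K.scaleEven = φ := by
  obtain ⟨r, hr⟩ := K.genSum_surjective (φ 1)
  refine ⟨∑ i, r i • LinearMap.proj i, LinearMap.ext_ring ?_⟩
  rw [← hr]
  ext
  simp [coe_genSum, coe_scaleEven, Algebra.smul_def]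

lemma exists_extend_cosyz (φ : K.cosyz →ₗ[R] K.odd) :
    ∃ ψ : (Fin 3 → K.odd) →ₗ[R] K.odd, ψ ∘ₗ K.cosyz.subtype = φ := by
  let a (i : Fin 3) : K.odd := φ (K.toCosyz (Pi.single i 1))
  have hφ (w : Fin 3 → R) : φ (K.toCosyz w) = ∑ i, w i • a i := by
    conv_lhs => rw [pi_eq_sum_univ' w]
    simp [a]
  -- The pullback to R³ kills the triple x₀·x, which gives x₀(x·a) = 0. Hence `a` is a cross product
  -- of `x` with an even triple, and that triple defines the extension.
  have ha : K.dot a = 0 := by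
    apply K.algebraMap_injective
    have h := hφ (K.scaleOdd (K.gen 0))
    rw [K.exact_scaleOdd_toCosyz.apply_apply_eq_zero, map_zero] at h
    have h' := congrArg Subtype.val h
    simp [scaleOdd, Algebra.smul_def, algebraMap_mulX, coe_gen, Fin.sum_univ_three] at h'
    rw [algebraMap_dot, Fin.sum_univ_three, map_zero]
    refine K.regular_zero _ ?_
    linear_combination -h'
  obtain ⟨r, hr⟩ := (K.exact_crossEven_dot a).1 ha
  refine ⟨-∑ i, r i • LinearMap.proj i, LinearMap.ext fun s => ?_⟩
  obtain ⟨w, rfl⟩ := K.toCosyz_surjective s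
  rw [hφ, ← hr]
  ext
  simp [coe_toCosyz, crossEven_apply, Fin.sum_univ_three, Algebra.smul_def, coe_gen]
  ring

/-- Pulled back to triples of odd elements the map is a dot product with some `r` that vanishes on
all cross products of `x`. Two basis vectors already show that `r` is an odd multiple of `x`, and
that multiple is the value of the extension at 1. -/
lemma exists_extend_maximalIdeal (φ : IsLocalRing.maximalIdeal R →ₗ[R] K.odd) :
    ∃ ψ : R →ₗ[R] K.odd, ψ ∘ₗ (IsLocalRing.maximalIdeal R).subtype = φ := by
  obtain ⟨r, hr⟩ := K.exists_hom_odd_pow (φ ∘ₗ K.toMaximalIdeal)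
  have hw (w : Fin 3 → R) : ∑ i, r i • K.crossEven w i = 0 := by
    rw [← hr, LinearMap.comp_apply]
    have := K.exact_cosyz_toMaximalIdeal.apply_apply_eq_zero (K.toCosyz w)
    exact (congrArg φ this).trans (map_zero φ)
  obtain ⟨a, ha⟩ := K.exact_cross_even r (by
    have := congrArg Subtype.val (hw ![0, 0, 1])
    simp [crossEven_apply, Fin.sum_univ_three, Algebra.smul_def, coe_gen] at this
    linear_combination -this) (by
    have := congrArg Subtype.val (hw ![0, 1, 0])
    simp [crossEven_apply, Fin.sum_univ_three, Algebra.smul_def, coe_gen] at this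
    linear_combination -this)
  refine ⟨LinearMap.toSpanSingleton R K.odd a, LinearMap.ext fun s => ?_⟩
  obtain ⟨v, rfl⟩ := K.toMaximalIdeal_surjective s
  have h := hr v
  rw [LinearMap.comp_apply] at h
  rw [h]
  ext
  simp [toMaximalIdeal, ha, Algebra.smul_def, algebraMap_dot, Fin.sum_univ_three]
  ring

/-- A map R³ → A is given by an odd triple `v`, and it sends a·x to (x·v)a. So it extends the
homothety `r` exactly when x·v = r, and the elements x·v fill the maximal ideal. -/
lemma mem_maximalIdeal_iff_extend (r : R) : r ∈ IsLocalRing.maximalIdeal R ↔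
    ∃ ψ : (Fin 3 → R) →ₗ[R] K.odd, ψ ∘ₗ K.scaleOdd = r • LinearMap.id := by
  constructor
  · intro hr
    obtain ⟨v, rfl⟩ : r ∈ LinearMap.range K.dot := K.range_dot ▸ hr
    refine ⟨Fintype.linearCombination R v, LinearMap.ext fun a => Subtype.ext ?_⟩
    simp [Fintype.linearCombination_apply, scaleOdd, Algebra.smul_def, algebraMap_mulX,
      algebraMap_dot, Fin.sum_univ_three]
    ring
  · rintro ⟨ψ, hψ⟩
    let v (i : Fin 3) : K.odd := ψ (Pi.single i 1)
    have hv (w : Fin 3 → R) : ψ w = ∑ i, w i • v i := by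
      conv_lhs => rw [pi_eq_sum_univ' w]
      simp [v]
    rw [← K.range_dot]
    refine ⟨v, K.algebraMap_injective ?_⟩
    have h := congrArg Subtype.val (LinearMap.congr_fun hψ (K.gen 0))
    rw [LinearMap.comp_apply, hv] at h
    simp [scaleOdd, Algebra.smul_def, algebraMap_mulX, coe_gen, Fin.sum_univ_three] at h
    rw [algebraMap_dot, Fin.sum_univ_three, ← sub_eq_zero]
    refine K.regular_zero _ ?_
    linear_combination h

end Extend

/-- The sequences 0 → syz → R³ → A → 0 and 0 → R → A³ → syz → 0 feed each other. Vanishing for `syz`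
in one degree gives vanishing for `A` in the next, and this gives it for `syz` there. Degree one
rests on the extension lemmas. -/
lemma subsingleton_ext_odd (n : ℕ) : Subsingleton (ModuleExt R K.odd K.odd (n + 1)) ∧
    Subsingleton (ModuleExt R K.syz K.odd (n + 1)) := by
  have hfree (n : ℕ) : Subsingleton (ModuleExt R (Fin 3 → R) K.odd (n + 1)) :=
    ModuleExt.subsingleton_of_projective n
  have hself (n : ℕ) : Subsingleton (ModuleExt R R K.odd (n + 1)) :=
    ModuleExt.subsingleton_of_projective n
  induction n with
  | zero =>
    have h1 : Subsingleton (ModuleExt R K.odd K.odd 1) := by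
      have := hfree 0
      exact ModuleExt.subsingleton_one_right K.syz.subtype K.genSum (Subtype.val_injective)
        K.genSum_surjective (LinearMap.exact_subtype_ker_map _) K.exists_extend_syz
    have : Subsingleton (ModuleExt R (Fin 3 → K.odd) K.odd 1) := ModuleExt.subsingleton_pi _
    exact ⟨h1, ModuleExt.subsingleton_one_right K.scaleEven K.toSyz K.scaleEven_injective
      K.toSyz_surjective K.exact_scaleEven_toSyz K.exists_extend_scaleEven⟩
  | succ n ih =>
    obtain ⟨-, h⟩ := ih
    have h1 : Subsingleton (ModuleExt R K.odd K.odd (n + 2)) := by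
      have := hfree (n + 1)
      exact ModuleExt.subsingleton_right K.syz.subtype K.genSum (Subtype.val_injective)
        K.genSum_surjective (LinearMap.exact_subtype_ker_map _)
    have : Subsingleton (ModuleExt R (Fin 3 → K.odd) K.odd (n + 2)) :=
      ModuleExt.subsingleton_pi _
    have := hself n
    exact ⟨h1, ModuleExt.subsingleton_right K.scaleEven K.toSyz K.scaleEven_injective
      K.toSyz_surjective K.exact_scaleEven_toSyz⟩

lemma subsingleton_ext_odd_pow (n : ℕ) :
    Subsingleton (ModuleExt R (Fin 3 → K.odd) K.odd (n + 1)) :=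
  have := (K.subsingleton_ext_odd n).1
  ModuleExt.subsingleton_pi _

lemma length_ext_cosyz_one : Module.length R (ModuleExt R K.cosyz K.odd 1) = 1 := by
  have : Subsingleton (ModuleExt R (Fin 3 → R) K.odd 1) := ModuleExt.subsingleton_of_projective 0
  rw [ModuleExt.length_one_eq K.scaleOdd K.toCosyz K.scaleOdd_injective K.toCosyz_surjective
    K.exact_scaleOdd_toCosyz (IsLocalRing.maximalIdeal R) K.exists_end_eq
    K.mem_maximalIdeal_iff_extend]
  rw [Module.length_eq_one_iff]
  exact isSimpleModule_iff_isCoatom.2 (IsLocalRing.maximalIdeal.isMaximal R).out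

lemma subsingleton_ext_cosyz (n : ℕ) : Subsingleton (ModuleExt R K.cosyz K.odd (n + 2)) := by
  have : Subsingleton (ModuleExt R (Fin 3 → R) K.odd (n + 2)) :=
    ModuleExt.subsingleton_of_projective _
  have := (K.subsingleton_ext_odd n).1
  exact ModuleExt.subsingleton_right K.scaleOdd K.toCosyz K.scaleOdd_injective
    K.toCosyz_surjective K.exact_scaleOdd_toCosyz

lemma subsingleton_ext_maximalIdeal_one :
    Subsingleton (ModuleExt R (IsLocalRing.maximalIdeal R) K.odd 1) := by
  have := K.subsingleton_ext_odd_pow 0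
  exact ModuleExt.subsingleton_one_right (X := K.cosyz) K.cosyz.subtype K.toMaximalIdeal
    Subtype.val_injective
    K.toMaximalIdeal_surjective K.exact_cosyz_toMaximalIdeal K.exists_extend_cosyz

lemma length_ext_maximalIdeal (n : ℕ) :
    Module.length R (ModuleExt R (IsLocalRing.maximalIdeal R) K.odd (n + 2)) =
      Module.length R (ModuleExt R K.cosyz K.odd (n + 1)) := by
  have := K.subsingleton_ext_odd_pow n
  have := K.subsingleton_ext_odd_pow (n + 1)
  exact ModuleExt.length_eq K.cosyz.subtype K.toMaximalIdeal Subtype.val_injective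
    K.toMaximalIdeal_surjective K.exact_cosyz_toMaximalIdeal

lemma length_ext_residueField (n : ℕ) :
    Module.length R (ModuleExt R (IsLocalRing.ResidueField R) K.odd (n + 2)) =
      Module.length R (ModuleExt R (IsLocalRing.maximalIdeal R) K.odd (n + 1)) := by
  have h (n : ℕ) : Subsingleton (ModuleExt R R K.odd (n + 1)) :=
    ModuleExt.subsingleton_of_projective n
  have := h n
  have := h (n + 1)
  exact ModuleExt.length_eq (IsLocalRing.maximalIdeal R).subtype
    (Algebra.linearMap R (IsLocalRing.ResidueField R)) Subtype.val_injective
    IsLocalRing.residue_surjective (exact_maximalIdeal_residue R)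

lemma subsingleton_ext_residueField_one :
    Subsingleton (ModuleExt R (IsLocalRing.ResidueField R) K.odd 1) := by
  have : Subsingleton (ModuleExt R R K.odd 1) := ModuleExt.subsingleton_of_projective 0
  exact ModuleExt.subsingleton_one_right (IsLocalRing.maximalIdeal R).subtype
    (Algebra.linearMap R (IsLocalRing.ResidueField R)) Subtype.val_injective
    IsLocalRing.residue_surjective (exact_maximalIdeal_residue R) K.exists_extend_maximalIdeal

lemma subsingleton_ext_residueField_zero :
    Subsingleton (ModuleExt R (IsLocalRing.ResidueField R) K.odd 0) := by
  refine ModuleExt.subsingleton_zero fun φ => LinearMap.ext fun c => Subtype.ext ?_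
  -- The square of `x 0` lies in the maximal ideal, so it kills the residue field and hence every
  -- value of `φ`.
  refine K.regular_zero _ (K.regular_zero _ ?_)
  have hm := K.mulX_mem 0 (K.gen 0)
  have h : K.mulX 0 (K.gen 0) • φ c = 0 := by
    rw [← map_smul, Algebra.smul_def, IsLocalRing.ResidueField.algebraMap_eq,
      (IsLocalRing.residue_eq_zero_iff _).2 hm, zero_mul, map_zero]
  simpa [Algebra.smul_def, algebraMap_mulX, coe_gen, mul_assoc] using congrArg Subtype.val h

/-- The odd part is a canonical module if `R` has dimension three. -/
theorem isCanonicalModule_odd (hd : dim R = 3) : IsCanonicalModule R K.odd := by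
  refine ⟨Module.Finite.of_surjective K.genSum K.genSum_surjective, fun i => ?_⟩
  rw [hd]
  change Module.length R (ModuleExt R (IsLocalRing.ResidueField R) K.odd i) = _
  -- The only survivor is Ext³(κ, A), which has the length of Ext²(𝔪, A), of Ext¹(cosyz, A) and
  -- finally of R/𝔪.
  match i with
  | 0 => rw [if_neg (by simp)]
         exact Module.length_eq_zero_iff.2 K.subsingleton_ext_residueField_zero
  | 1 => rw [if_neg (by simp)]
         exact Module.length_eq_zero_iff.2 K.subsingleton_ext_residueField_one
  | 2 => rw [if_neg (by simp), length_ext_residueField]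
         exact Module.length_eq_zero_iff.2 K.subsingleton_ext_maximalIdeal_one
  | 3 => rw [if_pos rfl, length_ext_residueField, length_ext_maximalIdeal,
           length_ext_cosyz_one]
  | n + 4 => rw [if_neg (by simp), length_ext_residueField, length_ext_maximalIdeal]
             exact Module.length_eq_zero_iff.2 (K.subsingleton_ext_cosyz n)

end KoszulCover

/-! ### Membership in 𝔪F and the zeroth Betti number of a minimal cover -/

section MinimalCover

variable {R : Type u} [CommRing R]

lemma mem_smul_top_pi {F : Type*} [AddCommGroup F] [Module R F] {ι : Type*} [Finite ι]
    (I : Ideal R) (v : ι → F) (h : ∀ i, v i ∈ I • (⊤ : Submodule R F)) :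
    v ∈ I • (⊤ : Submodule R (ι → F)) := by
  classical
  have := Fintype.ofFinite ι
  rw [← LinearMap.sum_single_apply (fun _ : ι => F) v]
  refine sum_mem fun i _ => ?_
  have h1 := Submodule.mem_map_of_mem (f := LinearMap.single R (fun _ : ι => F) i) (h i)
  rw [Submodule.map_smul''] at h1
  exact Submodule.smul_mono le_rfl le_top h1

lemma mem_smul_top_prod {F G : Type*} [AddCommGroup F] [Module R F] [AddCommGroup G] [Module R G]
    (I : Ideal R) (v : F × G) (h : v.1 ∈ I • (⊤ : Submodule R F))
    (h' : v.2 ∈ I • (⊤ : Submodule R G)) : v ∈ I • (⊤ : Submodule R (F × G)) := by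
  have h1 := Submodule.mem_map_of_mem (f := LinearMap.inl R F G) h
  have h2 := Submodule.mem_map_of_mem (f := LinearMap.inr R F G) h'
  rw [Submodule.map_smul''] at h1 h2
  have := add_mem (Submodule.smul_mono le_rfl le_top h1) (Submodule.smul_mono le_rfl le_top h2)
  simpa using this

lemma mem_smul_top_self (I : Ideal R) {r : R} (h : r ∈ I) : r ∈ I • (⊤ : Submodule R R) := by
  simpa using h

lemma exact_compLeft {A B C : Type*} [AddCommGroup A] [AddCommGroup B] [AddCommGroup C]
    [Module R A] [Module R B] [Module R C] (f : A →ₗ[R] B) (g : B →ₗ[R] C)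
    (h : Function.Exact f g) (ι : Type*) : Function.Exact (f.compLeft ι) (g.compLeft ι) := by
  intro v
  constructor
  · intro hv
    choose w hw using fun i => (h (v i)).1 (congrFun hv i)
    exact ⟨w, funext hw⟩
  · rintro ⟨w, rfl⟩
    exact funext fun i => h.apply_apply_eq_zero (w i)

variable [IsLocalRing R]

lemma betti_zero_of_free (F : Type u) [AddCommGroup F] [Module R F] [Module.Free R F]
    [Module.Finite R F] : betti R F 0 = Module.finrank R F := by
  have e := TensorProduct.quotTensorEquivQuotSMul F (IsLocalRing.maximalIdeal R)
  rw [betti_zero, ← e.length_eq]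
  change Module.length R (TensorProduct R (IsLocalRing.ResidueField R) F) = _
  rw [Module.length_eq_of_surjective (S := R) (R := IsLocalRing.ResidueField R)
    IsLocalRing.residue_surjective, Module.length_eq_finrank, Module.finrank_baseChange]

/-- A minimal free cover computes the zeroth Betti number. -/
lemma betti_zero_of_cover {K F M : Type u} [AddCommGroup K] [AddCommGroup F] [AddCommGroup M]
    [Module R K] [Module R F] [Module R M] [Module.Free R F] [Module.Finite R F] (f : K →ₗ[R] F)
    (g : F →ₗ[R] M) (hg : Function.Surjective g) (h : Function.Exact f g)
    (hm : ∀ m, f m ∈ IsLocalRing.maximalIdeal R • (⊤ : Submodule R F)) :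
    betti R M 0 = Module.finrank R F := by
  rw [← betti_zero_of_free, betti_zero, betti_zero]
  let q : F →ₗ[R] M ⧸ IsLocalRing.maximalIdeal R • (⊤ : Submodule R M) :=
    (Submodule.mkQ _) ∘ₗ g
  have hq : LinearMap.ker q = IsLocalRing.maximalIdeal R • (⊤ : Submodule R F) := by
    have : LinearMap.ker q =
        (IsLocalRing.maximalIdeal R • (⊤ : Submodule R M)).comap g := by
      rw [LinearMap.ker_comp, Submodule.ker_mkQ]
    rw [this]
    -- The cover maps 𝔪F onto 𝔪M, so the preimage of 𝔪M is 𝔪F plus the kernel. Minimality absorbs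
    -- the kernel.
    have h2 : IsLocalRing.maximalIdeal R • (⊤ : Submodule R M) =
        (IsLocalRing.maximalIdeal R • (⊤ : Submodule R F)).map g := by
      rw [Submodule.map_smul'', Submodule.map_top, LinearMap.range_eq_top.2 hg]
    rw [h2, Submodule.comap_map_eq, sup_eq_left, LinearMap.exact_iff.1 h]
    rintro _ ⟨m, rfl⟩
    exact hm m
  have hqs : Function.Surjective q := (Submodule.mkQ_surjective _).comp hg
  rw [← hq]
  exact (q.quotKerEquivOfSurjective hqs).length_eq.symm

end MinimalCover

/-! ### The minimal resolution of the odd part, its Betti numbers and the free rank -/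

namespace KoszulCover

section Corner

variable {R : Type u} [CommRing R]

/-- The matrix of size three with the given entries and last entry zero. -/
def cornerMatrix : ((Fin 2 → Fin 3 → R) × (Fin 2 → R)) →ₗ[R] (Fin 3 → Fin 3 → R) where
  toFun M := ![M.1 0, M.1 1, ![M.2 0, M.2 1, 0]]
  map_add' M N := by ext i j; fin_cases i <;> fin_cases j <;> simp
  map_smul' r M := by ext i j; fin_cases i <;> fin_cases j <;> simp

/-- Subtracting a multiple of the identity matrix to make the last entry zero. -/
def corner : (Fin 3 → Fin 3 → R) →ₗ[R] ((Fin 2 → Fin 3 → R) × (Fin 2 → R)) where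
  toFun N := (![![N 0 0 - N 2 2, N 0 1, N 0 2], ![N 1 0, N 1 1 - N 2 2, N 1 2]],
    ![N 2 0, N 2 1])
  map_add' M N := by
    ext i j
    · fin_cases i <;> fin_cases j <;> simp <;> ring
    · fin_cases i <;> simp
  map_smul' r M := by
    ext i j
    · fin_cases i <;> fin_cases j <;> simp <;> ring
    · fin_cases i <;> simp

/-- The 3×3 matrices split into multiples of the identity and matrices with last entry zero. The
identity maps to the triple `x`, which generates the kernel of A³ → syz, so dropping it leaves eight
of the nine generators. -/
lemma cornerMatrix_corner (N : Fin 3 → Fin 3 → R) (i : Fin 3) :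
    cornerMatrix (corner N) i = N i - Pi.single i (N 2 2) := by
  ext j
  fin_cases i <;> fin_cases j <;> simp [cornerMatrix, corner]

lemma corner_cornerMatrix_sub (M : (Fin 2 → Fin 3 → R) × (Fin 2 → R)) (r : R) :
    corner (fun i => cornerMatrix M i - Pi.single i r) = M := by
  ext i j
  · fin_cases i <;> fin_cases j <;> simp [cornerMatrix, corner]
  · fin_cases i <;> simp [cornerMatrix, corner]

end Corner

variable {R T : Type u} [CommRing R] [IsLocalRing R] [CommRing T] [Algebra R T]
  (K : KoszulCover R T)

/-- The minimal free cover of the syzygies of the odd part. -/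
def syzCover : ((Fin 2 → Fin 3 → R) × (Fin 2 → R)) →ₗ[R] K.syz :=
  K.toSyz ∘ₗ K.genSum.compLeft (Fin 3) ∘ₗ cornerMatrix

/-- The inclusion of the second syzygies of the odd part. -/
def syzInclusion : (Fin 3 → K.syz) →ₗ[R] ((Fin 2 → Fin 3 → R) × (Fin 2 → R)) :=
  corner ∘ₗ K.syz.subtype.compLeft (Fin 3)

lemma genSum_sub_single (v : Fin 3 → R) (r : R) (i : Fin 3) :
    K.genSum (v - Pi.single i r) = K.genSum v - r • K.gen i := by
  simp [genSum]

lemma mem_syz_sub_single (v : Fin 3 → R) (r : R) (i : Fin 3) :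
    v - Pi.single i r ∈ K.syz ↔ K.genSum v = K.scaleEven r i := by
  rw [LinearMap.mem_ker, genSum_sub_single, sub_eq_zero]
  rfl

/-- Lifting to A³ and then to R⁹ gives a matrix. Making its last entry zero changes the image in A³
by a multiple of `x`, which is killed in `syz`. -/
lemma syzCover_surjective : Function.Surjective K.syzCover := by
  intro s
  obtain ⟨v, rfl⟩ := K.toSyz_surjective s
  choose N hN using fun i => K.genSum_surjective (v i)
  refine ⟨corner N, ?_⟩
  have : (K.genSum.compLeft (Fin 3)) (cornerMatrix (corner N)) =
      v - K.scaleEven (N 2 2) := by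
    ext1 i
    rw [LinearMap.compLeft_apply, Function.comp_apply, cornerMatrix_corner, genSum_sub_single, hN]
    rfl
  rw [syzCover, LinearMap.comp_apply, LinearMap.comp_apply, this, map_sub,
    K.exact_scaleEven_toSyz.apply_apply_eq_zero, sub_zero]

/-- A matrix is in the kernel when, after subtracting some multiple of the identity, all its rows
are syzygies. This is where the three copies of `syz` come from. -/
lemma exact_syzInclusion_syzCover : Function.Exact K.syzInclusion K.syzCover := by
  intro M
  rw [syzCover, LinearMap.comp_apply, LinearMap.comp_apply, K.exact_scaleEven_toSyz _]
  constructor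
  · rintro ⟨r, hr⟩
    have h (i : Fin 3) : cornerMatrix M i - Pi.single i r ∈ K.syz := by
      rw [mem_syz_sub_single, hr]
      rfl
    exact ⟨fun i => ⟨_, h i⟩, corner_cornerMatrix_sub M r⟩
  · rintro ⟨N, rfl⟩
    refine ⟨-(N 2 : Fin 3 → R) 2, ?_⟩
    ext1 i
    rw [LinearMap.compLeft_apply, Function.comp_apply, syzInclusion, LinearMap.comp_apply,
      cornerMatrix_corner, genSum_sub_single]
    have : K.genSum (N i) = 0 := (N i).2
    change _ = K.genSum (N i) - (N 2 : Fin 3 → R) 2 • K.gen i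
    rw [this, zero_sub]
    exact neg_smul ((N 2 : Fin 3 → R) 2) (K.gen i)

/-- A matrix in the kernel is a multiple of the identity with syzygies as rows. The scalar then
kills `x`, so it is zero. -/
lemma syzInclusion_injective : Function.Injective K.syzInclusion := by
  rw [injective_iff_map_eq_zero]
  intro N hN
  have h (i : Fin 3) : (N i : Fin 3 → R) - Pi.single i ((N 2 : Fin 3 → R) 2) = 0 := by
    have := cornerMatrix_corner (fun i => (N i : Fin 3 → R)) i
    rw [← this]
    change cornerMatrix (K.syzInclusion N) i = 0
    rw [hN, map_zero]
    rfl
  have h0 : K.scaleEven ((N 2 : Fin 3 → R) 2) = 0 := by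
    ext1 i
    rw [← (K.mem_syz_sub_single 0 _ i).1, map_zero]
    · rfl
    · have : (0 : Fin 3 → R) - Pi.single i ((N 2 : Fin 3 → R) 2) = - (N i : Fin 3 → R) := by
        rw [sub_eq_zero.1 (h i), zero_sub]
      rw [this]
      exact neg_mem (N i).2
  have h1 := K.scaleEven_injective (h0.trans (map_zero _).symm)
  ext1 i
  have := h i
  rw [h1, Pi.single_zero, sub_zero] at this
  exact Subtype.ext this

lemma syzInclusion_mem (N : Fin 3 → K.syz) : K.syzInclusion N ∈
    IsLocalRing.maximalIdeal R • (⊤ : Submodule R ((Fin 2 → Fin 3 → R) × (Fin 2 → R))) := by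
  have h (i j : Fin 3) := K.syz_apply_mem (N i).2 j
  refine mem_smul_top_prod _ _ (mem_smul_top_pi _ _ fun i => mem_smul_top_pi _ _ fun j =>
    mem_smul_top_self _ ?_) (mem_smul_top_pi _ _ fun i => mem_smul_top_self _ ?_)
  · fin_cases i <;> fin_cases j <;> simp [syzInclusion, corner] <;>
      first | exact h _ _ | exact sub_mem (h _ _) (h _ _)
  · fin_cases i <;> simp [syzInclusion, corner] <;> exact h _ _

/-- The kernel of the cover R⁸ → syz is three copies of `syz`, so each step multiplies by 3.
Arbitrary finite powers are needed for the induction to apply to this kernel. -/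
lemma betti_syz_pow (i : ℕ) (ι : Type) [Fintype ι] :
    betti R (ι → K.syz) i = (Fintype.card ι * (8 * 3 ^ i) : ℕ) := by
  induction i generalizing ι with
  | zero =>
    rw [betti_zero_of_cover (K.syzInclusion.compLeft ι) (K.syzCover.compLeft ι)
      K.syzCover_surjective.comp_left (exact_compLeft _ _ K.exact_syzInclusion_syzCover ι)
      (fun m => mem_smul_top_pi _ _ fun i => K.syzInclusion_mem _)]
    simp [Module.finrank_pi_fintype]
  | succ i ih =>
    rw [betti_succ (K.syzInclusion.compLeft ι) (K.syzCover.compLeft ι)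
      K.syzInclusion_injective.comp_left
      K.syzCover_surjective.comp_left (exact_compLeft _ _ K.exact_syzInclusion_syzCover ι)
      (fun m => mem_smul_top_pi _ _ fun i => K.syzInclusion_mem _),
      ← betti_congr (LinearEquiv.curry R K.syz ι (Fin 3)), ih]
    simp [pow_succ]
    ring

section FreeOdd

variable (a b : ℕ)

/-- The free cover of a direct sum of copies of `R` and of the odd part. -/
def freeOddCover : ((Fin a → R) × (Fin b → Fin 3 → R)) →ₗ[R] ((Fin a → R) × (Fin b → K.odd)) :=
  LinearMap.prodMap LinearMap.id (K.genSum.compLeft (Fin b))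

/-- The kernel of the free cover of a direct sum of copies of `R` and of the odd part. -/
def freeOddInclusion : (Fin b → K.syz) →ₗ[R] ((Fin a → R) × (Fin b → Fin 3 → R)) :=
  LinearMap.inr R _ _ ∘ₗ K.syz.subtype.compLeft (Fin b)

lemma freeOddCover_surjective : Function.Surjective (K.freeOddCover a b) :=
  Function.surjective_id.prodMap K.genSum_surjective.comp_left

lemma freeOddInclusion_injective : Function.Injective (K.freeOddInclusion a b) :=
  LinearMap.inr_injective.comp (Subtype.val_injective.comp_left)

lemma exact_freeOdd : Function.Exact (K.freeOddInclusion a b) (K.freeOddCover a b) := by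
  rintro ⟨v, w⟩
  constructor
  · intro h
    obtain ⟨h1, h2⟩ := Prod.mk.inj h
    obtain ⟨u, hu⟩ := (exact_compLeft _ _ (LinearMap.exact_subtype_ker_map K.genSum) (Fin b) w).1 h2
    exact ⟨u, Prod.ext h1.symm hu⟩
  · rintro ⟨u, hu⟩
    rw [← hu]
    exact Prod.ext rfl ((exact_compLeft _ _ (LinearMap.exact_subtype_ker_map K.genSum)
      (Fin b)).apply_apply_eq_zero u)

lemma freeOddInclusion_mem (m : Fin b → K.syz) : K.freeOddInclusion a b m ∈
    IsLocalRing.maximalIdeal R • (⊤ : Submodule R ((Fin a → R) × (Fin b → Fin 3 → R))) :=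
  mem_smul_top_prod _ _ (zero_mem _) (mem_smul_top_pi _ _ fun i => mem_smul_top_pi _ _ fun j =>
    mem_smul_top_self _ (K.syz_apply_mem (m i).2 j))

lemma betti_freeOdd_zero :
    betti R ((Fin a → R) × (Fin b → K.odd)) 0 = (a + b * 3 : ℕ) := by
  rw [betti_zero_of_cover _ _ (K.freeOddCover_surjective a b) (K.exact_freeOdd a b)
    (K.freeOddInclusion_mem a b)]
  simp [Module.finrank_pi_fintype]

lemma betti_freeOdd_succ (i : ℕ) :
    betti R ((Fin a → R) × (Fin b → K.odd)) (i + 1) = (b * (8 * 3 ^ i) : ℕ) := by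
  rw [betti_succ _ _ (K.freeOddInclusion_injective a b) (K.freeOddCover_surjective a b)
    (K.exact_freeOdd a b) (K.freeOddInclusion_mem a b), betti_syz_pow, Fintype.card_fin]

end FreeOdd

/-- The odd part as a direct sum with one summand. -/
def oddEquivFreeOdd : K.odd ≃ₗ[R] (Fin 0 → R) × (Fin 1 → K.odd) :=
  (LinearEquiv.funUnique (Fin 1) R K.odd).symm.trans (LinearEquiv.uniqueProd).symm

lemma betti_odd_zero : betti R K.odd 0 = 3 := by
  rw [betti_congr K.oddEquivFreeOdd, betti_freeOdd_zero]
  norm_num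

lemma betti_odd_succ (i : ℕ) : betti R K.odd (i + 1) = 8 * 3 ^ i := by
  rw [betti_congr K.oddEquivFreeOdd, betti_freeOdd_succ]
  simp

/-- The free rank of a direct sum of copies of `R` and of the odd part. -/
lemma le_of_surjective_freeOdd {a b n : ℕ} (g : ((Fin a → R) × (Fin b → K.odd)) →ₗ[R] (Fin n → R))
    (hg : Function.Surjective g) : n ≤ a := by
  have hodd (w : Fin b → K.odd) :
      g (0, w) ∈ IsLocalRing.maximalIdeal R • (⊤ : Submodule R (Fin n → R)) := by
    refine mem_smul_top_pi _ _ fun i => mem_smul_top_self _ ?_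
    have h : (LinearMap.proj i ∘ₗ g ∘ₗ LinearMap.inr R (Fin a → R) (Fin b → K.odd)) w ∈
        IsLocalRing.maximalIdeal R := by
      rw [← LinearMap.sum_single_apply (fun _ : Fin b => K.odd) w, map_sum]
      exact sum_mem fun j _ => K.dual_apply_mem ((LinearMap.proj i ∘ₗ g ∘ₗ
        LinearMap.inr R (Fin a → R) (Fin b → K.odd)) ∘ₗ
          LinearMap.single R (fun _ : Fin b => K.odd) j) (w j)
    exact h
  let g' : (Fin a → R) →ₗ[R] (Fin n → R) := g ∘ₗ LinearMap.inl R _ _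
  have h1 : (⊤ : Submodule R (Fin n → R)) ≤
      LinearMap.range g' ⊔ IsLocalRing.maximalIdeal R • (⊤ : Submodule R (Fin n → R)) := by
    intro y _
    obtain ⟨⟨v, w⟩, rfl⟩ := hg y
    have : g (v, w) = g' v + g (0, w) := by
      simp [g', ← map_add]
    rw [this]
    exact Submodule.add_mem_sup (LinearMap.mem_range_self _ _) (hodd w)
  -- By Nakayama the free part alone maps onto Rⁿ, because the odd summands land in 𝔪Rⁿ.
  have h2 := Submodule.le_of_le_smul_of_le_jacobson_bot Module.Finite.fg_top
    (IsLocalRing.maximalIdeal_le_jacobson _) h1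
  exact le_of_fin_surjective R g' (LinearMap.range_eq_top.1 (top_le_iff.1 h2))

lemma freeRank_eq {a b : ℕ} {M : Type u} [AddCommGroup M] [Module R M]
    (e : M ≃ₗ[R] (Fin a → R) × (Fin b → K.odd)) : freeRank R M = a := by
  refine IsGreatest.csSup_eq ⟨?_, ?_⟩
  · refine ⟨(LinearMap.range (LinearMap.inl R (Fin a → R) (Fin b → K.odd))).map e.symm.toLinearMap,
      (LinearMap.range (LinearMap.inr R (Fin a → R) (Fin b → K.odd))).map e.symm.toLinearMap,
      ?_, ⟨?_⟩⟩
    · exact LinearMap.isCompl_range_inl_inr.map (Submodule.orderIsoMapComap e.symm)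
    · exact ((e.symm.submoduleMap _).symm).trans
        (LinearEquiv.ofInjective _ LinearMap.inl_injective).symm
  · rintro n ⟨F, N, hFN, ⟨φ⟩⟩
    refine K.le_of_surjective_freeOdd (φ.toLinearMap ∘ₗ (F.projectionOnto N hFN) ∘ₗ
      e.symm.toLinearMap) ?_
    exact φ.surjective.comp ((Submodule.projectionOnto_surjective hFN).comp e.symm.surjective)

end KoszulCover

/-! ### Bases of a ring over its q-th powers -/

/-- `b` is a basis of the ring `T` over its subring of `q`-th powers. -/
def IsFrobeniusBasis {T ι : Type*} [CommRing T] [Fintype ι] (q : ℕ) (b : ι → T) : Prop :=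
  (∀ t, ∃ g : ι → T, t = ∑ i, g i ^ q * b i) ∧ ∀ g : ι → T, ∑ i, g i ^ q * b i = 0 → g = 0

namespace IsFrobeniusBasis

variable {T ι κ : Type*} [CommRing T] [Fintype ι] [Fintype κ]

lemma map_ringEquiv {T' : Type*} [CommRing T'] (f : T ≃+* T') {q : ℕ} {b : ι → T}
    (h : IsFrobeniusBasis q b) : IsFrobeniusBasis q (f ∘ b) := by
  refine ⟨fun t => ?_, fun g hg => ?_⟩
  · obtain ⟨g, hg⟩ := h.1 (f.symm t)
    refine ⟨f ∘ g, ?_⟩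
    rw [← f.apply_symm_apply t, hg]
    simp
  · have := h.2 (f.symm ∘ g) (f.injective (by simpa using hg))
    ext i
    have := congrFun this i
    simpa using this

lemma reindex {q : ℕ} {b : ι → T} (h : IsFrobeniusBasis q b) (e : κ ≃ ι) :
    IsFrobeniusBasis q (b ∘ e) := by
  refine ⟨fun t => ?_, fun g hg => ?_⟩
  · obtain ⟨g, hg⟩ := h.1 t
    exact ⟨g ∘ e, hg.trans (e.sum_comp fun i => g i ^ q * b i).symm⟩
  · have := h.2 (g ∘ e.symm) (by
      rw [← hg, ← e.sum_comp]
      simp)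
    ext i
    simpa using congrFun this (e i)

/-- The tower law: `b` is a basis over the p^e-th powers, and the p^e-th powers of `c` form a basis
of that subring over the next one. -/
lemma mul {p : ℕ} [Fact p.Prime] [CharP T p] {e q : ℕ} {b : ι → T} {c : κ → T}
    (hb : IsFrobeniusBasis (p ^ e) b) (hc : IsFrobeniusBasis q c) :
    IsFrobeniusBasis (q * p ^ e) fun i : ι × κ => c i.2 ^ p ^ e * b i.1 := by
  have key (g : ι × κ → T) : ∑ i, g i ^ (q * p ^ e) * (c i.2 ^ p ^ e * b i.1) =
      ∑ i, (∑ j, g (i, j) ^ q * c j) ^ p ^ e * b i := by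
    rw [Fintype.sum_prod_type]
    refine Finset.sum_congr rfl fun i _ => ?_
    rw [sum_pow_char_pow, Finset.sum_mul]
    refine Finset.sum_congr rfl fun j _ => ?_
    rw [pow_mul, mul_pow]
    ring
  refine ⟨fun t => ?_, fun g hg => ?_⟩
  · obtain ⟨a, rfl⟩ := hb.1 t
    choose h hh using fun i => hc.1 (a i)
    exact ⟨fun i => h i.1 i.2, by rw [key]; exact Finset.sum_congr rfl fun i _ => by rw [← hh]⟩
  · rw [key] at hg
    have h1 := hb.2 _ hg
    ext ⟨i, j⟩
    exact congrFun (hc.2 _ (congrFun h1 i)) j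

lemma zero_pow {p : ℕ} : IsFrobeniusBasis (p ^ 0) fun _ : Fin 1 => (1 : T) := by
  refine ⟨fun t => ⟨fun _ => t, by simp⟩, fun g hg => funext fun i => ?_⟩
  have h : g 0 = 0 := by simpa using hg
  rwa [Subsingleton.elim i 0]

lemma exists_iterate {p : ℕ} [Fact p.Prime] [CharP T p] {n : ℕ} {c : Fin n → T}
    (hc : IsFrobeniusBasis p c) (e : ℕ) :
    ∃ c' : Fin (n ^ e) → T, IsFrobeniusBasis (p ^ e) c' := by
  induction e with
  | zero => exact ⟨_, zero_pow⟩
  | succ e ih =>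
    obtain ⟨c', hc'⟩ := ih
    have h := hc'.mul hc
    rw [← pow_succ'] at h
    exact ⟨_, h.reindex finProdFinEquiv.symm⟩

end IsFrobeniusBasis

/-- The identity map from `ᵉR` to `R`. -/
def FrobeniusModule.toRing (R : Type u) [CommRing R] (p e : ℕ) : FrobeniusModule R p e ≃+ R :=
  AddEquiv.refl R

lemma FrobeniusModule.toRing_smul {R : Type u} [CommRing R] {p e : ℕ} [Fact p.Prime] [CharP R p]
    (r : R) (s : FrobeniusModule R p e) :
    toRing R p e (r • s) = r ^ p ^ e * toRing R p e s := by
  rw [← iterateFrobenius_def]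
  rfl

section Field

variable {k : Type u} [Field k] {p : ℕ} [Fact p.Prime] [CharP k p]

open FrobeniusModule

lemma toRing_sum_smul {n : ℕ} (g : Fin n → k) (b : Fin n → FrobeniusModule k p 1) :
    toRing k p 1 (∑ i, g i • b i) = ∑ i, g i ^ p * toRing k p 1 (b i) := by
  simp [toRing_smul]

lemma exists_isFrobeniusBasis (h : (frobenius k p).Finite) :
    ∃ (n : ℕ) (c : Fin n → k), IsFrobeniusBasis p c := by
  have hfin : Module.Finite k (FrobeniusModule k p 1) := by
    have h2 : (iterateFrobenius k p 1).Finite := by rwa [iterateFrobenius_one]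
    exact h2
  let b := Module.finBasis k (FrobeniusModule k p 1)
  refine ⟨_, fun i => toRing k p 1 (b i), fun t => ⟨b.repr ((toRing k p 1).symm t), ?_⟩,
    fun g hg => ?_⟩
  · rw [← toRing_sum_smul, b.sum_repr, AddEquiv.apply_symm_apply]
  · rw [← toRing_sum_smul, map_eq_zero_iff _ (toRing k p 1).injective] at hg
    exact funext (Fintype.linearIndependent_iff.1 b.linearIndependent g hg)

lemma IsFrobeniusBasis.finrank_eq {n : ℕ} {c : Fin n → k} (hc : IsFrobeniusBasis p c) :
    Module.finrank k (FrobeniusModule k p 1) = n := by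
  let c' : Fin n → FrobeniusModule k p 1 := (toRing k p 1).symm ∘ c
  have hc' (g : Fin n → k) : toRing k p 1 (∑ i, g i • c' i) = ∑ i, g i ^ p * c i := by
    simp [toRing_smul, c']
  have hli : LinearIndependent k c' := by
    rw [Fintype.linearIndependent_iff]
    intro g hg i
    refine congrFun (hc.2 g ?_) i
    rw [← hc', hg, map_zero]
  have hsp : ⊤ ≤ Submodule.span k (Set.range c') := by
    intro t _
    obtain ⟨g, hg⟩ := hc.1 (toRing k p 1 t)
    rw [Submodule.mem_span_range_iff_exists_fun]
    exact ⟨g, (toRing k p 1).injective ((hc' g).trans hg.symm)⟩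
  rw [Module.finrank_eq_card_basis (Module.Basis.mk hli hsp), Fintype.card_fin]

end Field

/-! ### Decomposing ᵉR along a homogeneous Frobenius basis -/

namespace KoszulCover

variable {R T : Type u} [CommRing R] [IsLocalRing R] [CommRing T] [Algebra R T]
  (K : KoszulCover R T)

lemma even_pow_eq_zero {a : T} (ha : K.even a = 0) {n : ℕ} (hn : Odd n) : K.even (a ^ n) = 0 := by
  obtain ⟨m, rfl⟩ := hn
  obtain ⟨r, -, hr⟩ := K.exists_mul a a ha ha
  rw [pow_add, pow_mul, pow_two, ← hr, ← map_pow, pow_one, even_algebraMap_mul, ha, mul_zero]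

variable {p : ℕ} [Fact p.Prime] [CharP T p] (e : ℕ)

/-- An odd power of an odd element is odd, so for odd `p` Frobenius respects the grading. An even
basis element selects the even part of its coefficient, and in the next lemma an odd one selects the
odd part. -/
lemma ev_frobenius_mul_even (hp : Odd p) (g : T) {b : T} (hb : K.ev b = b) :
    K.ev (g ^ p ^ e * b) = K.ev g ^ p ^ e * b := by
  have h1 : K.even (K.od g ^ p ^ e * b) = 0 := by
    rw [← hb, mul_comm, ev, even_algebraMap_mul, K.even_pow_eq_zero (K.even_od g) hp.pow, mul_zero]
  conv_lhs => rw [← K.ev_add_od g, add_pow_char_pow, add_mul, ev, map_add, h1, add_zero]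
  rw [← hb, ev, ev, ← map_pow, ← map_mul, K.even_algebraMap]

lemma ev_frobenius_mul_odd (hp : Odd p) (g : T) {b : T} (hb : K.even b = 0) :
    K.ev (g ^ p ^ e * b) = K.od g ^ p ^ e * b := by
  have h1 : K.even (K.ev g ^ p ^ e * b) = 0 := by
    rw [ev, ← map_pow, even_algebraMap_mul, hb, mul_zero]
  conv_lhs => rw [← K.ev_add_od g, add_pow_char_pow, add_mul, ev, map_add, h1, zero_add]
  rw [K.algebraMap_even_mul (K.even_pow_eq_zero (K.even_od g) hp.pow) hb]

variable [CharP R p] {ι₀ ι₁ : Type} [Fintype ι₀] [Fintype ι₁] (b₀ : ι₀ → T) (b₁ : ι₁ → T)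

/-- The `R`-linear map to `ᵉR` given by a Frobenius basis of `T`. -/
def frobeniusSum : ((ι₀ → R) × (ι₁ → K.odd)) →ₗ[R] FrobeniusModule R p e where
  toFun g := (K.even (∑ i, algebraMap R T (g.1 i) ^ p ^ e * b₀ i) +
    K.even (∑ i, (g.2 i : T) ^ p ^ e * b₁ i) : R)
  map_add' g h := by
    have h1 : K.even (∑ i, algebraMap R T ((g + h).1 i) ^ p ^ e * b₀ i) =
        K.even (∑ i, algebraMap R T (g.1 i) ^ p ^ e * b₀ i) +
        K.even (∑ i, algebraMap R T (h.1 i) ^ p ^ e * b₀ i) := by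
      simp [add_pow_char_pow, add_mul, Finset.sum_add_distrib]
    have h2 : K.even (∑ i, ((g + h).2 i : T) ^ p ^ e * b₁ i) =
        K.even (∑ i, (g.2 i : T) ^ p ^ e * b₁ i) +
        K.even (∑ i, (h.2 i : T) ^ p ^ e * b₁ i) := by
      simp [add_pow_char_pow, add_mul, Finset.sum_add_distrib]
    rw [h1, h2]
    exact add_add_add_comm (_ : R) _ _ _
  map_smul' r g := by
    have h1 : K.even (∑ i, algebraMap R T ((r • g).1 i) ^ p ^ e * b₀ i) =
        r ^ p ^ e * K.even (∑ i, algebraMap R T (g.1 i) ^ p ^ e * b₀ i) := by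
      rw [← even_algebraMap_mul, Finset.mul_sum]
      simp [mul_pow, mul_assoc]
    have h2 : K.even (∑ i, ((r • g).2 i : T) ^ p ^ e * b₁ i) =
        r ^ p ^ e * K.even (∑ i, (g.2 i : T) ^ p ^ e * b₁ i) := by
      rw [← even_algebraMap_mul, Finset.mul_sum]
      simp [mul_pow, mul_assoc, Algebra.smul_def]
    rw [h1, h2, ← mul_add]
    rfl

lemma algebraMap_frobeniusSum (hp : Odd p) (h₀ : ∀ i, K.ev (b₀ i) = b₀ i)
    (h₁ : ∀ i, K.even (b₁ i) = 0) (g : (ι₀ → R) × (ι₁ → K.odd)) :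
    algebraMap R T (K.frobeniusSum e (p := p) b₀ b₁ g : R) =
      ∑ i, algebraMap R T (g.1 i) ^ p ^ e * b₀ i + ∑ i, (g.2 i : T) ^ p ^ e * b₁ i := by
  change algebraMap R T (K.even (∑ i, algebraMap R T (g.1 i) ^ p ^ e * b₀ i) +
    K.even (∑ i, (g.2 i : T) ^ p ^ e * b₁ i)) = _
  have hg (i) : K.od (g.2 i) = g.2 i := K.od_of_even_eq_zero (g.2 i).2
  rw [map_add, map_sum, map_sum, map_sum, map_sum]
  congr 1
  · refine Finset.sum_congr rfl fun i _ => ?_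
    have := K.ev_frobenius_mul_even e hp (algebraMap R T (g.1 i)) (h₀ i)
    rwa [ev_algebraMap] at this
  · refine Finset.sum_congr rfl fun i _ => ?_
    have := K.ev_frobenius_mul_odd e hp (g.2 i) (h₁ i)
    rwa [hg] at this

/-- The decomposition of `ᵉR` given by a Frobenius basis of `T`. -/
lemma nonempty_equiv_frobeniusModule (hp : Odd p) (h₀ : ∀ i, K.ev (b₀ i) = b₀ i)
    (h₁ : ∀ i, K.even (b₁ i) = 0) (hb : IsFrobeniusBasis (p ^ e) (Sum.elim b₀ b₁)) :
    Nonempty (FrobeniusModule R p e ≃ₗ[R] (ι₀ → R) × (ι₁ → K.odd)) := by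
  refine ⟨(LinearEquiv.ofBijective (K.frobeniusSum e b₀ b₁) ⟨?_, ?_⟩).symm⟩
  · rw [injective_iff_map_eq_zero]
    intro g hg
    have h := K.algebraMap_frobeniusSum e b₀ b₁ hp h₀ h₁ g
    rw [hg] at h
    have h2 := hb.2 (Sum.elim (fun i => algebraMap R T (g.1 i)) fun i => (g.2 i : T)) (by
      rw [Fintype.sum_sum_type]
      simp only [Sum.elim_inl, Sum.elim_inr]
      rw [← h]
      exact map_zero (algebraMap R T))
    refine Prod.ext (funext fun i => ?_) (funext fun i => ?_)
    · exact K.algebraMap_injective ((congrFun h2 (Sum.inl i)).trans (map_zero _).symm)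
    · exact Subtype.ext (congrFun h2 (Sum.inr i))
  · intro r
    obtain ⟨s, rfl⟩ := (FrobeniusModule.toRing R p e).symm.surjective r
    -- Taking even parts of the expansion of an even element leaves even coefficients on `b₀` and
    -- odd ones on `b₁`.
    obtain ⟨g, hg⟩ := hb.1 (algebraMap R T s)
    refine ⟨(fun i => K.even (g (.inl i)), fun i => ⟨K.od (g (.inr i)), K.even_od _⟩), ?_⟩
    apply K.algebraMap_injective
    refine (K.algebraMap_frobeniusSum e b₀ b₁ hp h₀ h₁ _).trans ?_
    change _ = algebraMap R T s
    have h2 := congrArg K.ev hg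
    rw [ev_algebraMap, Fintype.sum_sum_type] at h2
    rw [h2, ev, map_add, map_add, map_sum, map_sum, map_sum, map_sum]
    congr 1
    · exact Finset.sum_congr rfl fun i _ => (K.ev_frobenius_mul_even e hp _ (h₀ i)).symm
    · exact Finset.sum_congr rfl fun i _ => (K.ev_frobenius_mul_odd e hp _ (h₁ i)).symm

end KoszulCover

/-! ### Frobenius twists and the colength of Frobenius powers -/

section Twist

variable (R : Type u) [CommRing R] (p e : ℕ)

/-- The additive group of `N`, to be regarded as an `R`-module through the `e`-fold Frobenius
map. -/
def FrobeniusTwist (_R : Type u) (_p _e : ℕ) (N : Type u) : Type u := N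

variable (N : Type u) [AddCommGroup N]

instance : AddCommGroup (FrobeniusTwist R p e N) := inferInstanceAs (AddCommGroup N)

variable [Fact p.Prime] [CharP R p] [Module R N]

instance : Module R (FrobeniusTwist R p e N) := Module.compHom N (iterateFrobenius R p e)

variable {R p e N}

variable (R p e N) in
/-- The identity map from the Frobenius twist of `N` to `N`. -/
def untwist : FrobeniusTwist R p e N ≃+ N := AddEquiv.refl N

lemma untwist_smul (r : R) (n : FrobeniusTwist R p e N) :
    untwist R p e N (r • n) = r ^ p ^ e • untwist R p e N n := by
  rw [← iterateFrobenius_def]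
  rfl

variable (p e) in
/-- A linear map, as a linear map between the Frobenius twists. -/
def twistMap {N' : Type u} [AddCommGroup N'] [Module R N'] (f : N →ₗ[R] N') :
    FrobeniusTwist R p e N →ₗ[R] FrobeniusTwist R p e N' where
  toFun := f
  map_add' := f.map_add
  map_smul' r n := f.map_smul (iterateFrobenius R p e r) n

variable (R N p e) in
-- Every submodule of `N` is also a submodule of its twist. This supplies finiteness of the length
-- before the exact formula can be used.
lemma length_le_length_twist : Module.length R N ≤ Module.length R (FrobeniusTwist R p e N) := by
  let F : Submodule R N → Submodule R (FrobeniusTwist R p e N) := fun P =>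
    { carrier := (P : Set N)
      add_mem' := P.add_mem
      zero_mem' := P.zero_mem
      smul_mem' := fun r n hn => P.smul_mem (iterateFrobenius R p e r) hn }
  have hF : StrictMono F := by
    intro P Q h
    exact h
  rw [← WithBot.coe_le_coe, Module.coe_length, Module.coe_length]
  exact Order.krullDim_le_of_strictMono F hF

variable [IsLocalRing R]

/-- Twisting is exact, and each simple factor is the residue field, whose twist has length `D`. -/
lemma length_twist_of_isFiniteLength {D : ℕ∞}
    (hD : Module.length R (FrobeniusTwist R p e (IsLocalRing.ResidueField R)) = D)
    (h : IsFiniteLength R N) :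
    Module.length R (FrobeniusTwist R p e N) = D * Module.length R N := by
  induction h with
  | of_subsingleton =>
    rename_i M _ _ _
    have : Subsingleton (FrobeniusTwist R p e M) := inferInstanceAs (Subsingleton M)
    rw [Module.length_eq_zero, Module.length_eq_zero, mul_zero]
  | of_simple_quotient h ih =>
    rename_i M _ _ P hs
    have h1 := Module.length_eq_add_of_exact (R := R) (twistMap p e P.subtype)
      (twistMap p e P.mkQ) Subtype.val_injective P.mkQ_surjective
      (LinearMap.exact_subtype_mkQ P)
    have h2 := Module.length_eq_add_of_exact (R := R) P.subtype P.mkQ Subtype.val_injective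
      P.mkQ_surjective (LinearMap.exact_subtype_mkQ P)
    obtain ⟨I, hI, ⟨φ⟩⟩ := isSimpleModule_iff_quot_maximal.1 hs
    obtain rfl := IsLocalRing.eq_maximalIdeal hI
    have h3 : Module.length R (FrobeniusTwist R p e (M ⧸ P)) = D := by
      rw [← hD]
      exact (LinearEquiv.ofBijective (twistMap p e φ.toLinearMap) φ.bijective).length_eq
    rw [h1, h2, ih, h3, Module.length_eq_one R (M ⧸ P), mul_add, mul_one]

lemma length_twist_residueField {n : ℕ} {c : Fin n → IsLocalRing.ResidueField R}
    (hc : IsFrobeniusBasis (p ^ e) c) :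
    Module.length R (FrobeniusTwist R p e (IsLocalRing.ResidueField R)) = n := by
  let φ : (Fin n → IsLocalRing.ResidueField R) →ₗ[R]
      FrobeniusTwist R p e (IsLocalRing.ResidueField R) :=
    { toFun := fun g => (untwist R p e _).symm (∑ i, g i ^ p ^ e * c i)
      map_add' := fun g h => by
        rw [← map_add]
        simp [add_pow_char_pow, add_mul, Finset.sum_add_distrib]
      map_smul' := fun r g => by
        apply (untwist R p e _).injective
        rw [RingHom.id_apply, untwist_smul, AddEquiv.apply_symm_apply, AddEquiv.apply_symm_apply,
          Finset.smul_sum]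
        simp [smul_pow] }
  have hφ : Function.Bijective φ := by
    constructor
    · rw [injective_iff_map_eq_zero]
      exact hc.2
    · intro t
      obtain ⟨g, hg⟩ := hc.1 t
      exact ⟨g, hg.symm⟩
  have hs : Module.length R (IsLocalRing.ResidueField R) = 1 :=
    Module.length_eq_one_iff.2
      (isSimpleModule_iff_isCoatom.2 (IsLocalRing.maximalIdeal.isMaximal R).out)
  rw [← (LinearEquiv.ofBijective φ hφ).length_eq, Module.length_pi_of_fintype]
  simp [hs]

-- As a set, 𝔪·ᵉR is the Frobenius power of the maximal ideal. So the quotient of ᵉR by 𝔪·ᵉR is the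
-- twist of the quotient ring, and its length is the zeroth Betti number.
open FrobeniusModule in
lemma length_twist_quotient_frobeniusPower :
    Module.length R (FrobeniusTwist R p e
      (R ⧸ frobeniusPower R p (IsLocalRing.maximalIdeal R) e)) =
      betti R (FrobeniusModule R p e) 0 := by
  rw [betti_zero]
  let J := frobeniusPower R p (IsLocalRing.maximalIdeal R) e
  let q : FrobeniusModule R p e →ₗ[R] FrobeniusTwist R p e (R ⧸ J) :=
    { toFun := fun s => (untwist R p e _).symm (Submodule.Quotient.mk (toRing R p e s))
      map_add' := fun s t => by simp
      map_smul' := fun r s => by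
        apply (untwist R p e _).injective
        rw [RingHom.id_apply, untwist_smul, AddEquiv.apply_symm_apply, AddEquiv.apply_symm_apply,
          toRing_smul]
        rfl }
  have hq0 (s : R) : (toRing R p e).symm s ∈ LinearMap.ker q ↔ s ∈ J := by
    rw [LinearMap.mem_ker, ← Submodule.Quotient.mk_eq_zero J,
      ← map_eq_zero_iff _ (untwist R p e (R ⧸ J)).symm.injective]
    rfl
  have hq : LinearMap.ker q =
      IsLocalRing.maximalIdeal R • (⊤ : Submodule R (FrobeniusModule R p e)) := by
    apply le_antisymm
    · intro s hs
      obtain ⟨s, rfl⟩ := (toRing R p e).symm.surjective s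
      rw [hq0] at hs
      refine Submodule.span_induction (p := fun (s : R) _ => (toRing R p e).symm s ∈
        IsLocalRing.maximalIdeal R • (⊤ : Submodule R (FrobeniusModule R p e))) ?_ ?_ ?_ ?_ hs
      · rintro _ ⟨r, hr, rfl⟩
        have h : (toRing R p e).symm (r ^ p ^ e) = r • (toRing R p e).symm 1 := by
          apply (toRing R p e).injective
          rw [toRing_smul, AddEquiv.apply_symm_apply, AddEquiv.apply_symm_apply, mul_one]
        change (toRing R p e).symm (r ^ p ^ e) ∈ _
        rw [h]
        exact Submodule.smul_mem_smul hr trivial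
      · rw [map_zero]
        exact zero_mem _
      · intro x y _ _ hx hy
        rw [map_add]
        exact add_mem hx hy
      -- The submodule 𝔪·ᵉR must absorb all ring multiples, not only those by p^e-th powers.
      -- Multiplication by `a` commutes with the twisted action.
      · intro a x _ hx
        refine Submodule.smul_induction_on (p := fun (s : FrobeniusModule R p e) =>
          (toRing R p e).symm (a * toRing R p e s) ∈ IsLocalRing.maximalIdeal R •
            (⊤ : Submodule R (FrobeniusModule R p e))) hx ?_ ?_
        · intro r hr s _
          have h : (toRing R p e).symm (a * toRing R p e (r • s)) =
              r • (toRing R p e).symm (a * toRing R p e s) := by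
            apply (toRing R p e).injective
            rw [AddEquiv.apply_symm_apply, toRing_smul, toRing_smul, AddEquiv.apply_symm_apply,
              mul_left_comm]
          rw [h]
          exact Submodule.smul_mem_smul hr trivial
        · intro s t hs ht
          rw [map_add, mul_add, map_add]
          exact add_mem hs ht
    · rw [Submodule.smul_le]
      intro r hr s _
      obtain ⟨t, ht⟩ := (toRing R p e).symm.surjective (r • s)
      rw [← ht, hq0]
      have : t = r ^ p ^ e * toRing R p e s := by
        rw [← toRing_smul, ← ht, AddEquiv.apply_symm_apply]
      rw [this]
      exact Ideal.mul_mem_right _ _ (Ideal.subset_span ⟨r, hr, rfl⟩)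
  have hqs : Function.Surjective q :=
    (untwist R p e _).symm.surjective.comp
      ((Submodule.mkQ_surjective J).comp (toRing R p e).surjective)
  rw [← hq]
  exact (q.quotKerEquivOfSurjective hqs).length_eq.symm

end Twist

open MvPolynomial

/-! ### The sign involution, the Veronese ring as its invariants, and killing variables -/

section Involution

variable (k : Type u) [Field k]

/-- The involution of `k[x, y, z]` that changes the signs of the variables. -/
def sign : MvPolynomial (Fin 3) k →ₐ[k] MvPolynomial (Fin 3) k :=
  aeval fun i => -(X i : MvPolynomial (Fin 3) k)

variable {k}

@[simp]
lemma sign_X (i : Fin 3) : sign k (X i) = -X i := by simp [sign]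

@[simp]
lemma sign_C (a : k) : sign k (C a) = C a := by simp [sign]

@[simp]
lemma sign_sign (f : MvPolynomial (Fin 3) k) : sign k (sign k f) = f := by
  have : (sign k).comp (sign k) = AlgHom.id k _ := by
    ext i
    simp
  exact DFunLike.congr_fun this f

lemma constantCoeff_sign (f : MvPolynomial (Fin 3) k) :
    constantCoeff (sign k f) = constantCoeff f := by
  induction f using MvPolynomial.induction_on with
  | C a => simp
  | add f g hf hg => simp [hf, hg]
  | mul_X f i hf => simp

lemma sign_monomial (n : Fin 3 →₀ ℕ) (a : k) :
    sign k (monomial n a) = (-1) ^ (∑ i, n i) * monomial n a := by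
  rw [monomial_eq, map_mul, sign_C, Finsupp.prod_fintype _ _ (by simp), map_prod, mul_left_comm,
    ← Finset.prod_pow_eq_pow_sum, ← Finset.prod_mul_distrib]
  simp only [map_pow, sign_X, ← mul_pow, neg_one_mul]

lemma coeff_sign (n : Fin 3 →₀ ℕ) (f : MvPolynomial (Fin 3) k) :
    coeff n (sign k f) = (-1) ^ (∑ i, n i) * coeff n f := by
  induction f using MvPolynomial.induction_on' with
  | monomial m a =>
    have h : ((-1) ^ (∑ i, m i) : MvPolynomial (Fin 3) k) = C ((-1) ^ (∑ i, m i)) := by simp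
    rw [sign_monomial, h, coeff_C_mul, coeff_monomial]
    split_ifs with hm
    · rw [hm]
    · simp
  | add f g hf hg => rw [map_add, coeff_add, coeff_add, hf, hg, mul_add]

lemma X_mul_X_mem_veronese (i j : Fin 3) : (X i * X j : MvPolynomial (Fin 3) k) ∈ veronese k := by
  have h (f) (hf : f ∈ ({X 0 ^ 2, X 1 ^ 2, X 2 ^ 2, X 0 * X 1, X 0 * X 2, X 1 * X 2} :
    Set (MvPolynomial (Fin 3) k))) : f ∈ veronese k := Algebra.subset_adjoin hf
  wlog hij : i ≤ j generalizing i j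
  · rw [mul_comm]
    exact this j i (le_of_not_ge hij)
  fin_cases i <;> fin_cases j <;> first | (exact absurd hij (by decide)) | (apply h; simp [pow_two])

lemma monomial_mem_veronese (m : ℕ) (n : Fin 3 →₀ ℕ) (hn : ∑ i, n i = 2 * m) (a : k) :
    monomial n a ∈ veronese k := by
  induction m generalizing n with
  | zero =>
    have : n = 0 := by
      ext i
      have := Finset.single_le_sum (f := fun i => n i) (fun _ _ => Nat.zero_le _)
        (Finset.mem_univ i)
      simp at this hn
      simp [hn]
    rw [this]
    exact (veronese k).algebraMap_mem a
  | succ m ih =>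
    have key (n : Fin 3 →₀ ℕ) (hn : ∑ i, n i ≠ 0) :
        ∃ (i : Fin 3) (n' : Fin 3 →₀ ℕ), n = n' + Finsupp.single i 1 := by
      obtain ⟨i, -, hi⟩ := Finset.exists_ne_zero_of_sum_ne_zero hn
      refine ⟨i, n - Finsupp.single i 1, (tsub_add_cancel_of_le ?_).symm⟩
      rw [Finsupp.single_le_iff]
      omega
    obtain ⟨i, n', rfl⟩ := key n (by omega)
    have h1 : ∑ i, n' i + 1 = 2 * (m + 1) := by
      rw [← hn]
      simp [Finset.sum_add_distrib, Finsupp.single_apply]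
    obtain ⟨j, n'', rfl⟩ := key n' (by omega)
    have h2 : ∑ i, n'' i + 1 = 2 * m + 1 := by
      have : ∑ i, n'' i + 1 + 1 = 2 * (m + 1) := by
        rw [← h1]
        simp [Finset.sum_add_distrib, Finsupp.single_apply]
      omega
    rw [← mul_one a, ← mul_one (a * 1), ← monomial_mul, ← monomial_mul, mul_assoc]
    exact mul_mem (ih n'' (by omega)) (X_mul_X_mem_veronese j i)

/-- The involution multiplies a coefficient by the sign of its degree. As 2 is invertible, a fixed
polynomial has only monomials of even degree, and these are products of pairs of variables. -/
lemma mem_veronese_iff (h2 : (2 : k) ≠ 0) (f : MvPolynomial (Fin 3) k) :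
    f ∈ veronese k ↔ sign k f = f := by
  constructor
  · intro hf
    have : veronese k ≤ AlgHom.equalizer (sign k) (AlgHom.id k _) := by
      refine Algebra.adjoin_le ?_
      rintro _ (rfl | rfl | rfl | rfl | rfl | rfl) <;> simp
    exact this hf
  · intro hf
    rw [f.as_sum]
    refine sum_mem fun n hn => ?_
    rcases Nat.even_or_odd' (∑ i, n i) with ⟨m, hm | hm⟩
    · exact monomial_mem_veronese m n hm _
    · exfalso
      have h := coeff_sign n f
      rw [hf, hm, Odd.neg_one_pow ⟨m, rfl⟩] at h
      have h3 : 2 * coeff n f = 0 := by linear_combination h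
      exact (mem_support_iff.1 hn) ((mul_eq_zero.1 h3).resolve_left h2)

/-- The projection of `k[x, y, z]` to the part of even degree. -/
def evenPart (h2 : (2 : k) ≠ 0) : MvPolynomial (Fin 3) k →ₗ[veronese k] veronese k where
  toFun f := ⟨C (2⁻¹ : k) * (f + sign k f), by
    rw [mem_veronese_iff h2, map_mul, sign_C, map_add, sign_sign, add_comm]⟩
  map_add' f g := Subtype.ext (by
    simp only [AddMemClass.coe_add, map_add]
    ring)
  map_smul' v f := Subtype.ext (by
    have hv := (mem_veronese_iff h2 v).1 v.2
    simp only [Subalgebra.smul_def, smul_eq_mul, map_mul, hv, RingHom.id_apply,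
      MulMemClass.coe_mul]
    ring)

variable (h2 : (2 : k) ≠ 0)

lemma coe_evenPart (f : MvPolynomial (Fin 3) k) :
    (evenPart h2 f : MvPolynomial (Fin 3) k) = C (2⁻¹ : k) * (f + sign k f) := rfl

lemma C_half_mul_add (h2 : (2 : k) ≠ 0) (f : MvPolynomial (Fin 3) k) : C (2⁻¹ : k) * (f + f) = f := by
  rw [← two_mul, ← mul_assoc]
  have : (2 : MvPolynomial (Fin 3) k) = C 2 := (map_ofNat C 2).symm
  rw [this, ← C_mul, inv_mul_cancel₀ h2, C_1, one_mul]

lemma evenPart_of_sign_eq {f : MvPolynomial (Fin 3) k} (hf : sign k f = f) :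
    (evenPart h2 f : MvPolynomial (Fin 3) k) = f := by
  rw [coe_evenPart, hf, C_half_mul_add h2]

lemma evenPart_eq_zero_iff (f : MvPolynomial (Fin 3) k) : evenPart h2 f = 0 ↔ sign k f = -f := by
  rw [← Subtype.coe_inj, coe_evenPart, ZeroMemClass.coe_zero, mul_eq_zero, C_eq_zero, inv_eq_zero,
    or_iff_right h2, add_comm, add_eq_zero_iff_eq_neg]

lemma exists_eq_sum_X_mul (f : MvPolynomial (Fin 3) k) (hf : constantCoeff f = 0) :
    ∃ g : Fin 3 → MvPolynomial (Fin 3) k, f = ∑ i, g i * X i := by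
  have h : f ∈ Ideal.span (X '' Set.univ : Set (MvPolynomial (Fin 3) k)) := by
    rw [mem_ideal_span_X_image]
    intro m hm
    by_contra! h
    have : m = 0 := by ext i; exact h i trivial
    rw [this, mem_support_iff] at hm
    exact hm hf
  rw [Set.image_univ] at h
  obtain ⟨g, hg⟩ := Ideal.mem_span_range_iff_exists_fun.1 h
  exact ⟨g, hg.symm⟩

/-- The endomorphism of `k[x, y, z]` that kills the variables with index less than `n`. -/
def kill (k : Type u) [Field k] (n : ℕ) : MvPolynomial (Fin 3) k →ₐ[k] MvPolynomial (Fin 3) k :=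
  aeval fun i => if (i : ℕ) < n then 0 else X i

lemma kill_X (n : ℕ) (i : Fin 3) : kill k n (X i) = if (i : ℕ) < n then 0 else X i := by
  simp [kill]

lemma kill_three (f : MvPolynomial (Fin 3) k) : kill k 3 f = C (constantCoeff f) := by
  induction f using MvPolynomial.induction_on with
  | C a => simp [kill]
  | add f g hf hg => simp [hf, hg]
  | mul_X f i hf => rw [map_mul, kill_X, if_pos i.2]; simp

/-- Thus a polynomial killed by `kill k n` lies in the ideal of the first `n` variables, which is
what the regular sequence property needs. -/
lemma exists_sub_kill_eq (n : ℕ) (f : MvPolynomial (Fin 3) k) :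
    ∃ c : Fin 3 → MvPolynomial (Fin 3) k,
      f - kill k n f = ∑ i : Fin 3, if (i : ℕ) < n then X i * c i else 0 := by
  induction f using MvPolynomial.induction_on with
  | C a => exact ⟨0, by simp [kill]⟩
  | add f g hf hg =>
    obtain ⟨c, hc⟩ := hf
    obtain ⟨d, hd⟩ := hg
    refine ⟨c + d, ?_⟩
    have h : f + g - kill k n (f + g) = (f - kill k n f) + (g - kill k n g) := by
      rw [map_add]
      ring
    rw [h, hc, hd, ← Finset.sum_add_distrib]
    refine Finset.sum_congr rfl fun i _ => ?_
    split_ifs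
    · simp [mul_add]
    · simp
  | mul_X f j hf =>
    obtain ⟨c, hc⟩ := hf
    by_cases hj : (j : ℕ) < n
    · refine ⟨Pi.single j f, ?_⟩
      rw [map_mul, kill_X, if_pos hj, mul_zero, sub_zero, Finset.sum_eq_single j]
      · rw [if_pos hj, Pi.single_eq_same, mul_comm]
      · intro i _ hi
        rw [Pi.single_eq_of_ne hi, mul_zero, ite_self]
      · simp
    · refine ⟨fun i => c i * X j, ?_⟩
      rw [map_mul, kill_X, if_neg hj, ← sub_mul, hc, Finset.sum_mul]
      refine Finset.sum_congr rfl fun i _ => ?_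
      split_ifs <;> ring

lemma kill_sum (n : ℕ) (c : Fin 3 → MvPolynomial (Fin 3) k) :
    kill k n (∑ i : Fin 3, if (i : ℕ) < n then X i * c i else 0) = 0 := by
  rw [map_sum]
  refine Finset.sum_eq_zero fun i _ => ?_
  split_ifs with h
  · rw [map_mul, kill_X, if_pos h, zero_mul]
  · rw [map_zero]

end Involution

/-! ### The localized polynomial ring as a cover of the local Veronese ring -/

section Cover

variable (k : Type u) [Field k]

/-- The elements of the Veronese ring outside of the irrelevant ideal, inside `k[x, y, z]`. -/
abbrev coverSubmonoid : Submonoid (MvPolynomial (Fin 3) k) :=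
  Algebra.algebraMapSubmonoid (MvPolynomial (Fin 3) k) (irrelevantIdeal k).primeCompl

/-- The localization of `k[x, y, z]` over the local Veronese ring. -/
abbrev VeroneseCover : Type u := Localization (coverSubmonoid k)

instance : Algebra (VeroneseLocal k) (VeroneseCover k) :=
  localizationAlgebra (irrelevantIdeal k).primeCompl (MvPolynomial (Fin 3) k)

instance : IsLocalization (irrelevantIdeal k).primeCompl (VeroneseLocal k) :=
  inferInstanceAs (IsLocalization.AtPrime (VeroneseLocal k) (irrelevantIdeal k))

instance : IsScalarTower (veronese k) (VeroneseLocal k) (VeroneseCover k) :=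
  isScalarTower_localizationAlgebra (irrelevantIdeal k).primeCompl (MvPolynomial (Fin 3) k)

instance : IsLocalizedModule (irrelevantIdeal k).primeCompl
    (IsScalarTower.toAlgHom (veronese k) (MvPolynomial (Fin 3) k)
      (VeroneseCover k)).toLinearMap :=
  isLocalizedModule_iff_isLocalization.2 inferInstance

instance : IsLocalizedModule (irrelevantIdeal k).primeCompl
    (Algebra.linearMap (veronese k) (VeroneseLocal k)) := inferInstance

lemma coverSubmonoid_le : coverSubmonoid k ≤ nonZeroDivisors (MvPolynomial (Fin 3) k) := by
  apply le_nonZeroDivisors_of_noZeroDivisors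
  rintro ⟨v, hv, h⟩
  apply hv
  have : v = 0 := Subtype.ext h
  rw [this]
  exact zero_mem _

instance : IsDomain (VeroneseCover k) := IsLocalization.isDomain_localization (coverSubmonoid_le k)

variable {k}

lemma mem_irrelevantIdeal_iff (v : veronese k) :
    v ∈ irrelevantIdeal k ↔ constantCoeff (v : MvPolynomial (Fin 3) k) = 0 := Iff.rfl

lemma algebraMap_cover_injective :
    Function.Injective (algebraMap (MvPolynomial (Fin 3) k) (VeroneseCover k)) :=
  IsLocalization.injective _ (coverSubmonoid_le k)

lemma algebraMap_local_injective :
    Function.Injective (algebraMap (veronese k) (VeroneseLocal k)) :=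
  IsLocalization.injective _ (le_nonZeroDivisors_of_noZeroDivisors
    fun h : (0 : veronese k) ∈ (irrelevantIdeal k).primeCompl => h (zero_mem _))

lemma algebraMap_coe (v : veronese k) : algebraMap (MvPolynomial (Fin 3) k) (VeroneseCover k) v =
    algebraMap (VeroneseLocal k) (VeroneseCover k) (algebraMap _ _ v) := by
  rw [← IsScalarTower.algebraMap_apply, IsScalarTower.algebraMap_apply (veronese k)
    (MvPolynomial (Fin 3) k) (VeroneseCover k)]
  rfl

/-- Only elements of the Veronese ring are inverted, so finitely many fractions have a common even
denominator `v`, with inverse `u` in `R`. Parity questions then concern polynomial numerators only.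
-/
lemma exists_mul_eq_of_finite {ι : Type*} [Finite ι] (t : ι → VeroneseCover k) :
    ∃ u : VeroneseLocal k, IsUnit u ∧ ∃ (v : veronese k), v ∉ irrelevantIdeal k ∧
      algebraMap _ _ v * u = 1 ∧ ∃ s : ι → MvPolynomial (Fin 3) k,
      ∀ i, t i = algebraMap _ _ u * algebraMap _ _ (s i) := by
  obtain ⟨⟨_, v, hv, rfl⟩, h⟩ :=
    IsLocalization.exist_integer_multiples_of_finite (coverSubmonoid k) t
  choose s hs using h
  obtain ⟨u, hu⟩ := (IsLocalization.map_units (VeroneseLocal k)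
    (⟨v, hv⟩ : (irrelevantIdeal k).primeCompl)).exists_right_inv
  refine ⟨u, IsUnit.of_mul_eq_one_right _ hu, v, hv, hu, s, fun i => ?_⟩
  have h1 := hs i
  rw [Algebra.smul_def] at h1
  change _ = algebraMap _ _ (v : MvPolynomial (Fin 3) k) * t i at h1
  rw [h1, algebraMap_coe, ← mul_assoc, ← map_mul, mul_comm u, hu, map_one, one_mul]

lemma exists_mul_eq (t : VeroneseCover k) : ∃ u : VeroneseLocal k, IsUnit u ∧
    ∃ s : MvPolynomial (Fin 3) k, t = algebraMap _ _ u * algebraMap _ _ s := by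
  obtain ⟨u, hu, -, -, -, s, hs⟩ := exists_mul_eq_of_finite fun _ : Unit => t
  exact ⟨u, hu, s (), hs ()⟩

lemma exists_local_mul_eq (r : VeroneseLocal k) : ∃ u : VeroneseLocal k, IsUnit u ∧
    ∃ v : veronese k, r = u * algebraMap _ _ v := by
  obtain ⟨⟨v, w⟩, h⟩ := IsLocalization.surj (irrelevantIdeal k).primeCompl r
  obtain ⟨u, hu⟩ := (IsLocalization.map_units (VeroneseLocal k) w).exists_right_inv
  refine ⟨u, IsUnit.of_mul_eq_one_right _ hu, v, ?_⟩
  rw [← h, mul_comm u, mul_assoc, hu, mul_one]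

/-- After clearing denominators, killing the first `n` variables turns the relation into one saying
that the n-th variable annihilates the image of the numerator. In a domain that image is zero. -/
lemma cover_regular (n : ℕ) (hn : n < 3) (t : VeroneseCover k) (g : Fin 3 → VeroneseCover k)
    (h : algebraMap _ _ (X (⟨n, hn⟩ : Fin 3) : MvPolynomial (Fin 3) k) * t =
      ∑ i : Fin 3, if (i : ℕ) < n then
        algebraMap _ _ (X i : MvPolynomial (Fin 3) k) * g i else 0) :
    ∃ c : Fin 3 → VeroneseCover k, t = ∑ i : Fin 3, if (i : ℕ) < n then
        algebraMap _ _ (X i : MvPolynomial (Fin 3) k) * c i else 0 := by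
  obtain ⟨u, hu, -, -, -, s', hs⟩ := exists_mul_eq_of_finite fun o : Option (Fin 3) => o.elim t g
  let s := s' none
  have ht : t = algebraMap _ _ u * algebraMap _ _ s := hs none
  have hg (i : Fin 3) : g i = algebraMap _ _ u * algebraMap _ _ (s' (some i)) := hs (some i)
  have hu0 : algebraMap _ (VeroneseCover k) u ≠ 0 := (hu.map _).ne_zero
  have h1 : X ⟨n, hn⟩ * s =
      ∑ i : Fin 3, if (i : ℕ) < n then X i * s' (some i) else 0 := by
    apply algebraMap_cover_injective
    apply mul_left_cancel₀ hu0
    rw [map_mul, mul_left_comm, ← ht, h, map_sum, Finset.mul_sum]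
    refine Finset.sum_congr rfl fun i _ => ?_
    split_ifs
    · rw [hg, map_mul]
      ring
    · simp
  have h2 := congrArg (kill k n) h1
  rw [kill_sum, map_mul, kill_X, if_neg (lt_irrefl _), mul_eq_zero, or_iff_right (X_ne_zero _)]
    at h2
  obtain ⟨c, hc⟩ := exists_sub_kill_eq n s
  rw [h2, sub_zero] at hc
  refine ⟨fun i => algebraMap _ _ u * algebraMap _ _ (c i), ?_⟩
  rw [ht, hc, map_sum, Finset.mul_sum]
  refine Finset.sum_congr rfl fun i _ => ?_
  split_ifs
  · rw [map_mul]
    ring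
  · simp

variable (h2 : (2 : k) ≠ 0)

lemma constantCoeff_of_sign_eq_neg (h2 : (2 : k) ≠ 0) {s : MvPolynomial (Fin 3) k} (hs : sign k s = -s) :
    constantCoeff s = 0 := by
  have h := constantCoeff_sign s
  rw [hs, map_neg] at h
  have h3 : 2 * constantCoeff s = 0 := by linear_combination -h
  exact (mul_eq_zero.1 h3).resolve_left h2

/-- Any coefficients may be replaced by their odd parts, since `s` is even and the variables are
odd. -/
lemma exists_eq_sum_X_mul_odd (h2 : (2 : k) ≠ 0) {s : MvPolynomial (Fin 3) k} (hs : sign k s = s)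
    (h0 : constantCoeff s = 0) : ∃ o : Fin 3 → MvPolynomial (Fin 3) k,
      (∀ i, sign k (o i) = -o i) ∧ s = ∑ i, X i * o i := by
  obtain ⟨g, hg⟩ := exists_eq_sum_X_mul s h0
  refine ⟨fun i => C (2⁻¹ : k) * (g i - sign k (g i)), fun i => ?_, ?_⟩
  · rw [map_mul, sign_C, map_sub, sign_sign]
    ring
  · have h1 : sign k s = -∑ i, sign k (g i) * X i := by
      conv_lhs => rw [hg]
      simp
    conv_lhs => rw [← C_half_mul_add h2 s]
    have h3 : s + s = ∑ i, g i * X i - ∑ i, sign k (g i) * X i := by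
      rw [← hg]
      linear_combination h1 - hs
    rw [h3, ← Finset.sum_sub_distrib, Finset.mul_sum]
    refine Finset.sum_congr rfl fun i _ => ?_
    ring

/-- The projection of the cover to its even part. -/
def coverEven : VeroneseCover k →ₗ[VeroneseLocal k] VeroneseLocal k :=
  IsLocalizedModule.mapExtendScalars (irrelevantIdeal k).primeCompl
    (IsScalarTower.toAlgHom (veronese k) (MvPolynomial (Fin 3) k)
      (VeroneseCover k)).toLinearMap
    (Algebra.linearMap (veronese k) (VeroneseLocal k)) (VeroneseLocal k) (evenPart h2)

lemma coverEven_mul (u : VeroneseLocal k) (s : MvPolynomial (Fin 3) k) :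
    coverEven h2 (algebraMap _ _ u * algebraMap _ _ s) = u * algebraMap _ _ (evenPart h2 s) := by
  rw [← Algebra.smul_def, map_smul, smul_eq_mul]
  congr 1
  exact IsLocalizedModule.map_apply (irrelevantIdeal k).primeCompl
    (IsScalarTower.toAlgHom (veronese k) (MvPolynomial (Fin 3) k)
      (VeroneseCover k)).toLinearMap
    (Algebra.linearMap (veronese k) (VeroneseLocal k)) (evenPart h2) s

lemma coverEven_algebraMap (s : MvPolynomial (Fin 3) k) :
    coverEven h2 (algebraMap _ _ s) = algebraMap _ _ (evenPart h2 s) := by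
  simpa using coverEven_mul h2 1 s

lemma coverEven_mul_eq_zero_iff {u : VeroneseLocal k} (hu : IsUnit u)
    (s : MvPolynomial (Fin 3) k) :
    coverEven h2 (algebraMap _ _ u * algebraMap _ _ s) = 0 ↔ sign k s = -s := by
  rw [coverEven_mul, hu.mul_right_eq_zero, map_eq_zero_iff _ algebraMap_local_injective,
    evenPart_eq_zero_iff]

/-- The cover of the local Veronese ring by the localized polynomial ring. -/
def koszulCover : KoszulCover (VeroneseLocal k) (VeroneseCover k) where
  even := coverEven h2
  x i := algebraMap _ _ (X i : MvPolynomial (Fin 3) k)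
  even_algebraMap r := by
    have h := coverEven_mul h2 r 1
    have h1 : evenPart h2 1 = 1 := Subtype.ext (evenPart_of_sign_eq h2 (map_one _))
    rwa [h1, map_one, map_one, mul_one, mul_one] at h
  even_x i := by
    rw [coverEven_algebraMap, (evenPart_eq_zero_iff h2 _).2 (sign_X i), map_zero]
  exists_mul a b ha hb := by
    obtain ⟨u, hu, s, rfl⟩ := exists_mul_eq a
    obtain ⟨w, hw, t, rfl⟩ := exists_mul_eq b
    rw [coverEven_mul_eq_zero_iff h2 hu] at ha
    rw [coverEven_mul_eq_zero_iff h2 hw] at hb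
    have hst : s * t ∈ veronese k := by
      rw [mem_veronese_iff h2, map_mul, ha, hb, neg_mul_neg]
    refine ⟨u * w * algebraMap _ _ (⟨s * t, hst⟩ : veronese k), ?_, ?_⟩
    · refine Ideal.mul_mem_left _ _ ?_
      rw [IsLocalization.AtPrime.to_map_mem_maximal_iff (VeroneseLocal k) (irrelevantIdeal k),
        mem_irrelevantIdeal_iff, map_mul, constantCoeff_of_sign_eq_neg h2 ha, zero_mul]
    · rw [map_mul, ← algebraMap_coe, map_mul, map_mul]
      ring
  exists_eq_sum a ha := by
    obtain ⟨u, hu, s, rfl⟩ := exists_mul_eq a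
    rw [coverEven_mul_eq_zero_iff h2 hu] at ha
    obtain ⟨g, hg⟩ := exists_eq_sum_X_mul s (constantCoeff_of_sign_eq_neg h2 ha)
    refine ⟨fun i => u * algebraMap _ _ (evenPart h2 (g i)), ?_⟩
    have h : s = ∑ i, (evenPart h2 (g i) : MvPolynomial (Fin 3) k) * X i := by
      have h1 : sign k s = -∑ i, sign k (g i) * X i := by
        conv_lhs => rw [hg]
        simp
      conv_lhs => rw [← C_half_mul_add h2 s]
      have h3 : s + s = ∑ i, g i * X i + ∑ i, sign k (g i) * X i := by
        rw [← hg]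
        linear_combination -h1 + ha
      rw [h3, ← Finset.sum_add_distrib, Finset.mul_sum]
      refine Finset.sum_congr rfl fun i _ => ?_
      rw [coe_evenPart]
      ring
    conv_lhs => rw [h]
    rw [map_sum, Finset.mul_sum]
    refine Finset.sum_congr rfl fun i _ => ?_
    rw [map_mul, map_mul, ← algebraMap_coe, mul_assoc]
  exists_eq_sum_mul r hr := by
    obtain ⟨u, hu, v, rfl⟩ := exists_local_mul_eq r
    have hv : v ∈ irrelevantIdeal k := by
      rw [← IsLocalization.AtPrime.to_map_mem_maximal_iff (VeroneseLocal k) (irrelevantIdeal k)]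
      exact ((IsLocalRing.maximalIdeal.isMaximal _).isPrime.mem_or_mem hr).resolve_left
        fun h => (IsLocalRing.mem_maximalIdeal u).1 h hu
    obtain ⟨o, ho, h⟩ := exists_eq_sum_X_mul_odd h2 ((mem_veronese_iff h2 v).1 v.2) hv
    refine ⟨fun i => algebraMap _ _ u * algebraMap _ _ (o i),
      fun i => (coverEven_mul_eq_zero_iff h2 hu _).2 (ho i), ?_⟩
    rw [map_mul, ← algebraMap_coe, h, map_sum, Finset.mul_sum]
    refine Finset.sum_congr rfl fun i _ => ?_
    rw [map_mul]
    ring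
  regular_zero t h := by
    refine (mul_eq_zero.1 h).resolve_left fun h0 => X_ne_zero (R := k) (0 : Fin 3) ?_
    exact algebraMap_cover_injective (h0.trans (map_zero _).symm)
  regular_one t h := by
    obtain ⟨g, hg⟩ := h
    obtain ⟨c, hc⟩ := cover_regular 1 (by norm_num) t ![g, 0, 0] (by
      rw [Fin.sum_univ_three]
      simpa using hg)
    rw [Fin.sum_univ_three] at hc
    exact ⟨c 0, by simpa using hc⟩
  regular_two t a b h := by
    obtain ⟨c, hc⟩ := cover_regular 2 (by norm_num) t ![a, b, 0] (by
      rw [Fin.sum_univ_three]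
      simpa using h)
    rw [Fin.sum_univ_three] at hc
    exact ⟨c 0, c 1, by simpa using hc⟩

end Cover

/-! ### The Veronese ring localizes to dimension three -/

section Dimension

variable (k : Type u) [Field k]

instance : IsNoetherianRing (veronese k) := by
  have h : (veronese k).FG := Subalgebra.fg_def.2 ⟨_, by simp, rfl⟩
  have : Algebra.FiniteType k (veronese k) := ⟨Subalgebra.fg_top _ |>.2 h⟩
  exact Algebra.FiniteType.isNoetherianRing k _

/-- The elements of the Veronese ring that vanish when the first `n` variables are killed. -/
def killIdeal (n : ℕ) : Ideal (veronese k) :=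
  RingHom.ker ((kill k n).comp (veronese k).val)

instance (n : ℕ) : (killIdeal k n).IsPrime := RingHom.ker_isPrime _

lemma mem_killIdeal_iff (n : ℕ) (v : veronese k) :
    v ∈ killIdeal k n ↔ kill k n (v : MvPolynomial (Fin 3) k) = 0 := Iff.rfl

lemma killIdeal_three : killIdeal k 3 = irrelevantIdeal k := by
  ext v
  rw [mem_irrelevantIdeal_iff, mem_killIdeal_iff, kill_three, C_eq_zero]

/-- The product of two variables in the Veronese ring. -/
def quadric (i j : Fin 3) : veronese k := ⟨X i * X j, X_mul_X_mem_veronese i j⟩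

lemma coe_quadric (i j : Fin 3) : (quadric k i j : MvPolynomial (Fin 3) k) = X i * X j := rfl

lemma killIdeal_lt {n : ℕ} (hn : n < 3) : killIdeal k n < killIdeal k (n + 1) := by
  refine lt_of_le_of_ne (fun v hv => ?_) fun h => ?_
  · rw [mem_killIdeal_iff] at hv ⊢
    have hc : (kill k (n + 1)).comp (kill k n) = kill k (n + 1) := by
      ext1 i
      rw [AlgHom.comp_apply, kill_X, kill_X]
      split_ifs with h1 h2
      · exact map_zero _
      · omega
      · rw [kill_X, if_pos ‹_›]
      · rw [kill_X, if_neg ‹_›]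
    rw [← hc, AlgHom.comp_apply, hv, map_zero]
  -- The square of the n-th variable separates the two ideals.
  · have hv : quadric k ⟨n, hn⟩ ⟨n, hn⟩ ∈ killIdeal k (n + 1) := by
      rw [mem_killIdeal_iff, coe_quadric, map_mul, kill_X, if_pos (Nat.lt_succ_self n), zero_mul]
    rw [← h, mem_killIdeal_iff, coe_quadric, map_mul, kill_X, if_neg (lt_irrefl _)] at hv
    exact mul_ne_zero (X_ne_zero _) (X_ne_zero _) hv

variable {k}

lemma irrelevantIdeal_le (h2 : (2 : k) ≠ 0) {P : Ideal (veronese k)}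
    (h : ∀ i j, quadric k i j ∈ P) : irrelevantIdeal k ≤ P := by
  intro v hv
  have hsv := (mem_veronese_iff h2 v).1 v.2
  obtain ⟨o, hs, h1⟩ := exists_eq_sum_X_mul_odd h2 hsv hv
  choose g' hg' using fun i => exists_eq_sum_X_mul (o i) (constantCoeff_of_sign_eq_neg h2 (hs i))
  have h4 : v = ∑ i, ∑ j, evenPart h2 (g' i j) * quadric k j i := by
    have h5 (i j : Fin 3) : evenPart h2 (g' i j) * quadric k j i =
        evenPart h2 (g' i j * (X j * X i)) := by
      have := (evenPart h2).map_smul (quadric k j i) (g' i j)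
      rw [smul_eq_mul, mul_comm] at this
      rw [← this, Subalgebra.smul_def, smul_eq_mul, mul_comm]
      rfl
    simp only [h5, ← map_sum]
    refine Subtype.ext ?_
    rw [← evenPart_of_sign_eq h2 hsv]
    congr 2
    rw [h1]
    refine Finset.sum_congr rfl fun i _ => ?_
    rw [hg' i, Finset.mul_sum]
    exact Finset.sum_congr rfl fun j _ => by ring
  rw [h4]
  exact sum_mem fun i _ => sum_mem fun j _ => P.mul_mem_left _ (h j i)

/-- The upper bound is Krull's height theorem for the three squares: a prime containing them
contains each product of two variables, whose square is a product of two squares. The lower bound is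
the chain obtained by killing one variable at a time. -/
lemma height_irrelevantIdeal (h2 : (2 : k) ≠ 0) : (irrelevantIdeal k).height = 3 := by
  classical
  apply le_antisymm
  · let s : Finset (veronese k) := Finset.univ.image fun i => quadric k i i
    have hs : irrelevantIdeal k ∈ (Ideal.span (s : Set (veronese k))).minimalPrimes := by
      refine ⟨⟨inferInstance, ?_⟩, fun P hP _ => ?_⟩
      · rw [Ideal.span_le]
        intro v hv
        obtain ⟨i, -, rfl⟩ := Finset.mem_image.1 hv
        simp [mem_irrelevantIdeal_iff, coe_quadric]
      · have := hP.1
        refine irrelevantIdeal_le h2 fun i j => ?_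
        have hq (i) : quadric k i i ∈ P :=
          hP.2 (Ideal.subset_span (Finset.mem_image_of_mem _ (Finset.mem_univ i)))
        refine this.mem_of_pow_mem 2 ?_
        have : quadric k i j ^ 2 = quadric k i i * quadric k j j :=
          Subtype.ext (by
            simp only [coe_quadric, MulMemClass.coe_mul, SubmonoidClass.coe_pow]
            ring)
        rw [this]
        exact P.mul_mem_left _ (hq j)
    refine (Ideal.height_le_card_of_mem_minimalPrimes_span_finset hs).trans ?_
    exact_mod_cast Finset.card_image_le.trans (by simp)
  · have h (n : ℕ) (hn : n ≤ 3) : (n : ℕ∞) ≤ (killIdeal k n).height := by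
      induction n with
      | zero => simp
      | succ n ih =>
        have := Ideal.height_strict_mono_of_isPrime_of_isPrime
          (killIdeal_lt k (Nat.lt_of_succ_le hn))
        push_cast
        exact Order.add_one_le_of_lt ((ih (by omega)).trans_lt this)
    rw [← killIdeal_three]
    exact h 3 le_rfl

lemma dim_veroneseLocal (h2 : (2 : k) ≠ 0) : dim (VeroneseLocal k) = 3 := by
  rw [dim, IsLocalization.AtPrime.ringKrullDim_eq_height (irrelevantIdeal k) (VeroneseLocal k),
    height_irrelevantIdeal h2]
  rfl

end Dimension

/-! ### The monomial Frobenius basis of the polynomial ring -/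

section PolynomialBasis

variable {k : Type u} [Field k]

/-- A vector of natural numbers less than `q`, as an exponent. -/
def exponent {q : ℕ} (u : Fin 3 → Fin q) : Fin 3 →₀ ℕ :=
  Finsupp.equivFunOnFinite.symm fun i => u i

@[simp]
lemma exponent_apply {q : ℕ} (u : Fin 3 → Fin q) (i : Fin 3) : exponent u i = u i := rfl

lemma smul_add_exponent_inj {q : ℕ} {m n : Fin 3 →₀ ℕ} {u w : Fin 3 → Fin q} :
    q • m + exponent u = q • n + exponent w ↔ m = n ∧ u = w := by
  refine ⟨fun h => ?_, by rintro ⟨rfl, rfl⟩; rfl⟩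
  have h1 (i : Fin 3) : q * m i + u i = q * n i + w i := by simpa using DFunLike.congr_fun h i
  constructor
  · ext i
    have h2 := congrArg (· / q) (h1 i)
    have hq : 0 < q := (u i).pos
    simpa [Nat.mul_add_div hq, Nat.div_eq_of_lt] using h2
  · ext i
    have h2 := congrArg (· % q) (h1 i)
    simpa [Nat.mod_eq_of_lt] using h2

lemma exists_eq_smul_add_exponent {q : ℕ} (hq : 0 < q) (n : Fin 3 →₀ ℕ) :
    ∃ (m : Fin 3 →₀ ℕ) (u : Fin 3 → Fin q), n = q • m + exponent u := by
  refine ⟨Finsupp.equivFunOnFinite.symm fun i => n i / q,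
    fun i => ⟨n i % q, Nat.mod_lt _ hq⟩, ?_⟩
  ext i
  simp [Nat.div_add_mod]

variable {p : ℕ} [Fact p.Prime] [CharP k p]

/-- Every exponent of the product is `exponent w` modulo q, where q = p ^ e, and division with
remainder is unique. So a coefficient with remainder `u` sees only the basis monomial with w = u. -/
lemma coeff_pow_mul_monomial (e : ℕ) (g : MvPolynomial (Fin 3) k) (m : Fin 3 →₀ ℕ)
    (u w : Fin 3 → Fin (p ^ e)) (c : k) :
    coeff (p ^ e • m + exponent u) (g ^ p ^ e * monomial (exponent w) c) =
      if w = u then coeff m g ^ p ^ e * c else 0 := by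
  classical
  induction g using MvPolynomial.induction_on' with
  | monomial n a =>
    rw [monomial_pow, monomial_mul, coeff_monomial, coeff_monomial]
    simp only [smul_add_exponent_inj]
    by_cases hw : w = u <;> by_cases hn : n = m <;>
      simp [hw, hn, (Fact.out : p.Prime).ne_zero]
  | add f g hf hg =>
    rw [add_pow_char_pow, add_mul, coeff_add, coeff_add, hf, hg]
    split_ifs
    · rw [add_pow_char_pow, add_mul]
    · rw [add_zero]

lemma isFrobeniusBasis_monomial {e : ℕ} {ι : Type*} [Fintype ι] {c : ι → k}
    (hc : IsFrobeniusBasis (p ^ e) c) :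
    IsFrobeniusBasis (p ^ e) fun x : ι × (Fin 3 → Fin (p ^ e)) =>
      monomial (exponent x.2) (c x.1) := by
  classical
  have hq : 0 < p ^ e := pow_pos (Fact.out : p.Prime).pos e
  refine ⟨fun t => ?_, fun g hg => ?_⟩
  · induction t using MvPolynomial.induction_on' with
    | monomial n a =>
      obtain ⟨m, u, rfl⟩ := exists_eq_smul_add_exponent hq n
      obtain ⟨h, rfl⟩ := hc.1 a
      refine ⟨fun x => if x.2 = u then monomial m (h x.1) else 0, ?_⟩
      rw [Fintype.sum_prod_type, map_sum]
      refine Finset.sum_congr rfl fun j _ => ?_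
      simp only [ite_pow, zero_pow hq.ne', ite_mul, zero_mul, monomial_pow, monomial_mul]
      simp
    | add f g hf hg =>
      obtain ⟨a, ha⟩ := hf
      obtain ⟨b, hb⟩ := hg
      refine ⟨a + b, ?_⟩
      conv_lhs => rw [ha, hb, ← Finset.sum_add_distrib]
      refine Finset.sum_congr rfl fun x _ => ?_
      rw [Pi.add_apply, add_pow_char_pow, add_mul]
  · have h (m : Fin 3 →₀ ℕ) (u : Fin 3 → Fin (p ^ e)) :
        (fun j => coeff m (g (j, u))) = 0 := by
      apply hc.2
      have h := congrArg (coeff (p ^ e • m + exponent u)) hg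
      rw [coeff_sum, Fintype.sum_prod_type, coeff_zero] at h
      simpa only [coeff_pow_mul_monomial, Finset.sum_ite_eq', Finset.mem_univ, if_true] using h
    ext ⟨j, u⟩ m
    exact congrFun (h m u) j

end PolynomialBasis

/-! ### Transfer of the Frobenius basis to the localization -/

section CoverBasis

variable {k : Type u} [Field k]

instance (p : ℕ) [CharP k p] : CharP (VeroneseCover k) p :=
  charP_of_injective_ringHom
    ((algebraMap (MvPolynomial (Fin 3) k) (VeroneseCover k)).comp C).injective p

lemma IsFrobeniusBasis.algebraMap_cover {q : ℕ} (hq : 0 < q) {ι : Type*} [Fintype ι]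
    {b : ι → MvPolynomial (Fin 3) k} (hb : IsFrobeniusBasis q b) :
    IsFrobeniusBasis q fun i => algebraMap _ (VeroneseCover k) (b i) := by
  refine ⟨fun t => ?_, fun g hg => ?_⟩
  · obtain ⟨u, -, v, -, hv, s, hs⟩ := exists_mul_eq_of_finite fun _ : Unit => t
    -- The factor v^(q−1) turns the denominator into a q-th power: s/v = (v^(q−1) s)/v^q.
    obtain ⟨g, hg⟩ := hb.1 ((v : MvPolynomial (Fin 3) k) ^ (q - 1) * s ())
    refine ⟨fun i => algebraMap _ _ u * algebraMap _ _ (g i), ?_⟩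
    have hv' := congrArg (algebraMap (VeroneseLocal k) (VeroneseCover k)) hv
    rw [map_mul, ← algebraMap_coe, map_one] at hv'
    simp only [mul_pow, mul_assoc]
    rw [← Finset.mul_sum, hs ()]
    simp only [← map_pow, ← map_mul, ← map_sum]
    rw [← hg, map_mul, map_pow, map_pow]
    obtain ⟨q, rfl⟩ := Nat.exists_eq_succ_of_ne_zero hq.ne'
    rw [Nat.succ_sub_one, pow_succ]
    have h := congrArg (· ^ q) hv'
    simp only [mul_pow, one_pow] at h
    linear_combination
      (-algebraMap _ (VeroneseCover k) u * algebraMap _ (VeroneseCover k) (s ())) * h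
  · obtain ⟨u, hu, -, -, -, s, hs⟩ := exists_mul_eq_of_finite g
    have h : ∑ i, s i ^ q * b i = 0 := by
      apply algebraMap_cover_injective
      have hu0 := ((hu.map (algebraMap (VeroneseLocal k) (VeroneseCover k))).pow q).ne_zero
      apply mul_left_cancel₀ hu0
      rw [map_zero, mul_zero, ← hg, map_sum, Finset.mul_sum]
      refine Finset.sum_congr rfl fun i _ => ?_
      rw [hs, map_mul, map_pow]
      ring
    ext i
    rw [hs, hb.2 s h]
    simp

end CoverBasis

/-! ### Counting basis monomials by parity -/

section Count

/-- The sum is the cube of an alternating sum of `q` signs, which is 1 for odd `q`. -/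
lemma sum_neg_one_pow {q : ℕ} (hq : Odd q) :
    ∑ u : Fin 3 → Fin q, (-1 : ℤ) ^ (∑ i, (u i : ℕ)) = 1 := by
  simp only [← Finset.prod_pow_eq_pow_sum]
  have h := Finset.prod_univ_sum (fun _ : Fin 3 => (Finset.univ : Finset (Fin q)))
    fun _ j => (-1 : ℤ) ^ (j : ℕ)
  rw [Fintype.piFinset_univ] at h
  rw [← h, Fin.sum_univ_eq_sum_range fun j => (-1 : ℤ) ^ j, neg_one_geom_sum,
    if_neg (Nat.not_even_iff_odd.2 hq)]
  simp

lemma card_even_exponent {n q : ℕ} (hq : Odd q) :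
    Fintype.card {x : Fin n × (Fin 3 → Fin q) // Even (∑ i, (x.2 i : ℕ))} =
      Fintype.card {x : Fin n × (Fin 3 → Fin q) // ¬ Even (∑ i, (x.2 i : ℕ))} + n := by
  have h : ∑ x : Fin n × (Fin 3 → Fin q), (-1 : ℤ) ^ (∑ i, (x.2 i : ℕ)) = n := by
    rw [Fintype.sum_prod_type]
    simp [sum_neg_one_pow hq]
  have h1 (x : Fin n × (Fin 3 → Fin q)) : (-1 : ℤ) ^ (∑ i, (x.2 i : ℕ)) =
      if Even (∑ i, (x.2 i : ℕ)) then 1 else -1 := neg_one_pow_eq_ite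
  simp only [h1] at h
  rw [Finset.sum_ite, Finset.sum_const, Finset.sum_const] at h
  rw [Fintype.card_subtype, Fintype.card_subtype]
  simp only [nsmul_eq_mul, mul_one, mul_neg] at h
  zify
  linarith

lemma card_exponent (n q : ℕ) :
    Fintype.card {x : Fin n × (Fin 3 → Fin q) // Even (∑ i, (x.2 i : ℕ))} +
      Fintype.card {x : Fin n × (Fin 3 → Fin q) // ¬ Even (∑ i, (x.2 i : ℕ))} = n * q ^ 3 := by
  rw [← Fintype.card_sum, Fintype.card_congr (Equiv.sumCompl _)]
  simp

end Count

/-! ### The decomposition of ᵉR for the local Veronese ring -/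

section Decomposition

variable {k : Type u} [Field k] {p : ℕ} [Fact p.Prime] [CharP k p] (h2 : (2 : k) ≠ 0)

/-- Here `a` and `b` count the basis elements with monomial of even and odd degree. The constants
from `k` are even, so parity is decided by the monomial. -/
lemma exists_equiv_frobeniusModule (hp : Odd p) {n : ℕ} {c : Fin n → k}
    (hc : IsFrobeniusBasis p c) (e : ℕ) :
    ∃ a b : ℕ, a = b + n ^ e ∧ a + b = n ^ e * (p ^ e) ^ 3 ∧
      Nonempty (FrobeniusModule (VeroneseLocal k) p e ≃ₗ[VeroneseLocal k]
        (Fin a → VeroneseLocal k) × (Fin b → (koszulCover h2).odd)) := by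
  classical
  obtain ⟨c', hc'⟩ := hc.exists_iterate e
  refine ⟨_, _, card_even_exponent (hp.pow (n := e)), card_exponent (n ^ e) (p ^ e), ?_⟩
  let P (x : Fin (n ^ e) × (Fin 3 → Fin (p ^ e))) := Even (∑ i, (x.2 i : ℕ))
  let b (x : Fin (n ^ e) × (Fin 3 → Fin (p ^ e))) : VeroneseCover k :=
    algebraMap _ _ (monomial (exponent x.2) (c' x.1))
  let f₀ := (Fintype.equivFin {x // P x}).symm
  let f₁ := (Fintype.equivFin {x // ¬ P x}).symm
  have hb := (((isFrobeniusBasis_monomial hc').algebraMap_cover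
    (pow_pos (Fact.out : p.Prime).pos e)).reindex
      (Equiv.sumCompl P)).reindex (Equiv.sumCongr f₀ f₁)
  refine (koszulCover h2).nonempty_equiv_frobeniusModule e (fun i => b (f₀ i)) (fun i => b (f₁ i))
    hp (fun i => ?_) (fun i => ?_) ?_
  · have h : sign k (monomial (exponent (f₀ i).1.2) (c' (f₀ i).1.1)) = _ := sign_monomial _ _
    have h1 : Even (∑ j, exponent (f₀ i).1.2 j) := (f₀ i).2
    rw [h1.neg_one_pow, one_mul] at h
    change algebraMap _ _ (coverEven h2 (algebraMap _ _ _)) = _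
    rw [coverEven_algebraMap, ← algebraMap_coe, evenPart_of_sign_eq h2 h]
  · have h : sign k (monomial (exponent (f₁ i).1.2) (c' (f₁ i).1.1)) = _ := sign_monomial _ _
    have h1 : Odd (∑ j, exponent (f₁ i).1.2 j) := Nat.not_even_iff_odd.1 (f₁ i).2
    rw [h1.neg_one_pow, neg_one_mul] at h
    change coverEven h2 (algebraMap _ _ _) = 0
    rw [coverEven_algebraMap, (evenPart_eq_zero_iff h2 _).2 h, map_zero]
  · convert hb using 1
    ext (i | i) <;> rfl

end Decomposition

/-! ### The residue field and the colength 2q³ − 1 -/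

section ResidueField

variable (k : Type u) [Field k]

/-- The map from `k` to the residue field of the local Veronese ring. -/
def toResidueField : k →+* IsLocalRing.ResidueField (VeroneseLocal k) :=
  (IsLocalRing.residue (VeroneseLocal k)).comp
    ((algebraMap (veronese k) (VeroneseLocal k)).comp (algebraMap k (veronese k)))

variable {k}

lemma residue_algebraMap (v : veronese k) :
    IsLocalRing.residue (VeroneseLocal k) (algebraMap _ _ v) =
      toResidueField k (MvPolynomial.constantCoeff (v : MvPolynomial (Fin 3) k)) := by
  rw [← sub_eq_zero, toResidueField, RingHom.comp_apply, RingHom.comp_apply, ← map_sub, ← map_sub,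
    IsLocalRing.residue_eq_zero_iff,
    IsLocalization.AtPrime.to_map_mem_maximal_iff (VeroneseLocal k) (irrelevantIdeal k),
    mem_irrelevantIdeal_iff, AddSubgroupClass.coe_sub, map_sub, Subalgebra.coe_algebraMap,
    MvPolynomial.algebraMap_eq, MvPolynomial.constantCoeff_C, sub_self]

lemma toResidueField_bijective : Function.Bijective (toResidueField k) := by
  refine ⟨(toResidueField k).injective, fun x => ?_⟩
  obtain ⟨r, rfl⟩ := IsLocalRing.residue_surjective x
  obtain ⟨⟨v, w⟩, h⟩ := IsLocalization.surj (irrelevantIdeal k).primeCompl r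
  have h1 := congrArg (IsLocalRing.residue (VeroneseLocal k)) h
  rw [map_mul, residue_algebraMap, residue_algebraMap] at h1
  have hw : MvPolynomial.constantCoeff (w.1 : MvPolynomial (Fin 3) k) ≠ 0 := w.2
  refine ⟨MvPolynomial.constantCoeff (v : MvPolynomial (Fin 3) k) /
    MvPolynomial.constantCoeff (w.1 : MvPolynomial (Fin 3) k), ?_⟩
  rw [map_div₀, ← h1, mul_div_cancel_right₀]
  exact (map_ne_zero _).2 hw

lemma IsFrobeniusBasis.pos {p n : ℕ} {c : Fin n → k} (hc : IsFrobeniusBasis p c) : 0 < n := by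
  rw [Nat.pos_iff_ne_zero]
  rintro rfl
  obtain ⟨g, hg⟩ := hc.1 1
  simp at hg

variable {p : ℕ} [Fact p.Prime] [CharP k p] {n : ℕ} {c : Fin n → k}

lemma residueDegree_veroneseLocal (hc : IsFrobeniusBasis p c) :
    residueDegree (VeroneseLocal k) p = n :=
  (hc.map_ringEquiv (RingEquiv.ofBijective _ toResidueField_bijective)).finrank_eq

lemma length_twist_residueField_veroneseLocal (hc : IsFrobeniusBasis p c) (e : ℕ) :
    Module.length (VeroneseLocal k) (FrobeniusTwist (VeroneseLocal k) p e
      (IsLocalRing.ResidueField (VeroneseLocal k))) = (n ^ e : ℕ) := by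
  obtain ⟨c', hc'⟩ := hc.exists_iterate e
  exact length_twist_residueField
    (hc'.map_ringEquiv (RingEquiv.ofBijective _ toResidueField_bijective))

lemma length_quotient_frobeniusPower (h2 : (2 : k) ≠ 0) (hp : Odd p) (hc : IsFrobeniusBasis p c) (e : ℕ) :
    ∃ l : ℕ, l + 1 = 2 * (p ^ e) ^ 3 ∧ Module.length (VeroneseLocal k)
      (VeroneseLocal k ⧸ frobeniusPower (VeroneseLocal k) p
        (IsLocalRing.maximalIdeal (VeroneseLocal k)) e) = l := by
  obtain ⟨a, b, h, h', ⟨f⟩⟩ := exists_equiv_frobeniusModule h2 hp hc e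
  have hl := length_twist_quotient_frobeniusPower (R := VeroneseLocal k) (p := p) (e := e)
  rw [betti_congr (N := (Fin a → VeroneseLocal k) × (Fin b → (koszulCover h2).odd)) f, 
    (koszulCover h2).betti_freeOdd_zero] at hl
  have hle := length_le_length_twist (VeroneseLocal k) p e
    (VeroneseLocal k ⧸ frobeniusPower (VeroneseLocal k) p
        (IsLocalRing.maximalIdeal (VeroneseLocal k)) e)
  rw [hl] at hle
  have hne := ne_top_of_le_ne_top (ENat.natCast_ne_top _) hle
  rw [length_twist_of_isFiniteLength (length_twist_residueField_veroneseLocal hc e)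
    (Module.length_ne_top_iff.1 hne)] at hl
  obtain ⟨l, hl'⟩ := ENat.ne_top_iff_exists.1 hne
  refine ⟨l, ?_, hl'.symm⟩
  rw [← hl'] at hl
  have hl : n ^ e * l = a + b * 3 := by exact_mod_cast hl
  -- With N = n^e and q = p^e, a + 3b = (a + b) + 2b = 2Nq³ − N, so cancelling N leaves 2q³ − 1.
  apply Nat.eq_of_mul_eq_mul_left (pow_pos hc.pos e)
  linarith

end ResidueField

/-! ### The limits -/

section Limits

open Filter Topology

lemma tendsto_inv_pow_atTop {p : ℕ} (hp : 1 < p) :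
    Tendsto (fun e : ℕ => (((p : ℝ) ^ e) ^ 3)⁻¹) atTop (𝓝 0) := by
  have h : Tendsto (fun e : ℕ => ((p : ℝ) ^ e)⁻¹) atTop (𝓝 0) := by
    simp only [← inv_pow]
    exact tendsto_pow_atTop_nhds_zero_of_lt_one (by positivity)
      (inv_lt_one_of_one_lt₀ (by exact_mod_cast hp))
  simpa using h.pow 3

end Limits

variable {k : Type u} [Field k] {p : ℕ} [Fact p.Prime] [CharP k p] {n : ℕ} {c : Fin n → k}

lemma normalizer_veroneseLocal (h2 : (2 : k) ≠ 0) (hc : IsFrobeniusBasis p c) (e : ℕ) :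
    normalizer (VeroneseLocal k) p e = (n : ℝ) ^ e * ((p : ℝ) ^ e) ^ 3 := by
  rw [normalizer, dim_veroneseLocal h2, residueDegree_veroneseLocal hc]
  ring

lemma hasFSignature_veroneseLocal (h2 : (2 : k) ≠ 0) (hp : Odd p) (hc : IsFrobeniusBasis p c) :
    HasFSignature (VeroneseLocal k) p (1 / 2) := by
  have hn : (n : ℝ) ≠ 0 := Nat.cast_ne_zero.2 hc.pos.ne'
  have hp0 : (p : ℝ) ≠ 0 := Nat.cast_ne_zero.2 (Fact.out : p.Prime).ne_zero
  -- The ratio is exactly (1 + q⁻³)/2, where q = p^e.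
  have h := ((tendsto_inv_pow_atTop (Fact.out : p.Prime).one_lt).const_add 1).div_const 2
  rw [add_zero] at h
  refine h.congr fun e => ?_
  obtain ⟨a, b, hab, hab', ⟨f⟩⟩ := exists_equiv_frobeniusModule h2 hp hc e
  rw [(koszulCover h2).freeRank_eq f, normalizer_veroneseLocal h2 hc]
  have h1 : (a : ℝ) = b + n ^ e := by exact_mod_cast hab
  have h3 : (a : ℝ) + b = n ^ e * (p ^ e) ^ 3 := by exact_mod_cast hab'
  field_simp
  linarith

lemma hasFrobeniusBetti_veroneseLocal (h2 : (2 : k) ≠ 0) (hp : Odd p) (hc : IsFrobeniusBasis p c)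
    (i : ℕ) : HasFrobeniusBetti (VeroneseLocal k) p (i + 1) (4 * 3 ^ i) := by
  have hn : (n : ℝ) ≠ 0 := Nat.cast_ne_zero.2 hc.pos.ne'
  have hp0 : (p : ℝ) ≠ 0 := Nat.cast_ne_zero.2 (Fact.out : p.Prime).ne_zero
  -- The ratio is exactly 4·3^i(1 − q⁻³), since b is half of n^e(q³ − 1).
  have h := ((tendsto_inv_pow_atTop (Fact.out : p.Prime).one_lt).const_sub 1).const_mul
    (4 * (3 : ℝ) ^ i)
  rw [sub_zero, mul_one] at h
  refine h.congr fun e => ?_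
  obtain ⟨a, b, hab, hab', ⟨f⟩⟩ := exists_equiv_frobeniusModule h2 hp hc e
  rw [betti_congr (N := (Fin a → VeroneseLocal k) × (Fin b → (koszulCover h2).odd)) f, 
    (koszulCover h2).betti_freeOdd_succ, ENat.toNat_natCast,
    normalizer_veroneseLocal h2 hc]
  have h1 : (a : ℝ) = b + n ^ e := by exact_mod_cast hab
  have h3 : (a : ℝ) + b = n ^ e * (p ^ e) ^ 3 := by exact_mod_cast hab'
  have h4 : (b : ℝ) = (n ^ e * (p ^ e) ^ 3 - n ^ e) / 2 := by linarith
  push_cast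
  rw [h4]
  field_simp
  ring

lemma hasHilbertKunzMultiplicity_veroneseLocal (h2 : (2 : k) ≠ 0) (hp : Odd p)
    (hc : IsFrobeniusBasis p c) : HasHilbertKunzMultiplicity (VeroneseLocal k) p 2 := by
  have hp0 : (p : ℝ) ≠ 0 := Nat.cast_ne_zero.2 (Fact.out : p.Prime).ne_zero
  have h := (tendsto_inv_pow_atTop (Fact.out : p.Prime).one_lt).const_sub 2
  rw [sub_zero] at h
  refine h.congr fun e => ?_
  obtain ⟨l, hl, hl'⟩ := length_quotient_frobeniusPower h2 hp hc e
  rw [hl', ENat.toNat_natCast, dim_veroneseLocal h2]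
  have h1 : (l : ℝ) = 2 * (p ^ e) ^ 3 - 1 := eq_sub_of_add_eq (by exact_mod_cast hl)
  rw [h1, mul_comm 3 e, pow_mul]
  field_simp

end FrobeniusBetti

end

theorem theorem6 (k : Type u) [Field k] (p : ℕ) [Fact p.Prime] [CharP k p] (hp : 2 < p)
    (hF : (frobenius k p).Finite) :
    (∀ f : MvPolynomial (Fin 3) k,
      f ∈ veronese k ↔
        MvPolynomial.aeval (fun i : Fin 3 => -(MvPolynomial.X i : MvPolynomial (Fin 3) k)) f = f) ∧
    HasFSignature (VeroneseLocal k) p (1 / 2) ∧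
    HasHilbertKunzMultiplicity (VeroneseLocal k) p 2 ∧
    (∀ i : ℕ, 1 ≤ i →
      HasFrobeniusBetti (VeroneseLocal k) p i
        (4 * 3 ^ (i - 1))) ∧
    ∃ (A : Type u) (_ : AddCommGroup A) (_ : Module (VeroneseLocal k) A),
      IsCanonicalModule (VeroneseLocal k) A ∧
      (∀ e : ℕ, ∃ b : ℕ,
        Nonempty (FrobeniusModule (VeroneseLocal k) p e
          ≃ₗ[VeroneseLocal k]
          (Fin (freeRank (VeroneseLocal k)
            (FrobeniusModule (VeroneseLocal k) p e)) →
              VeroneseLocal k) × (Fin b → A))) ∧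
      betti (VeroneseLocal k) A 0 = 3 ∧
      ∀ i : ℕ, 1 ≤ i →
        betti (VeroneseLocal k) A i = 8 * 3 ^ (i - 1) := by
  have hodd : Odd p := (Fact.out : p.Prime).odd_of_ne_two hp.ne'
  have h2 : (2 : k) ≠ 0 := by
    intro h
    have h1 : ((2 : ℕ) : k) = 0 := by exact_mod_cast h
    exact hp.not_ge (Nat.le_of_dvd two_pos ((CharP.cast_eq_zero_iff k p 2).1 h1))
  obtain ⟨n, c, hc⟩ := exists_isFrobeniusBasis hF
  refine ⟨mem_veronese_iff h2, hasFSignature_veroneseLocal h2 hodd hc,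
    hasHilbertKunzMultiplicity_veroneseLocal h2 hodd hc, fun i hi => ?_,
    (koszulCover h2).odd, inferInstance, inferInstance,
    (koszulCover h2).isCanonicalModule_odd (dim_veroneseLocal h2), fun e => ?_,
    (koszulCover h2).betti_odd_zero, fun i hi => ?_⟩
  · obtain ⟨i, rfl⟩ := Nat.exists_eq_add_of_le' hi
    exact hasFrobeniusBetti_veroneseLocal h2 hodd hc i
  · obtain ⟨a, b, -, -, ⟨f⟩⟩ := exists_equiv_frobeniusModule h2 hodd hc e
    rw [(koszulCover h2).freeRank_eq f]
    exact ⟨b, ⟨f⟩⟩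
  · obtain ⟨i, rfl⟩ := Nat.exists_eq_add_of_le' hi
    exact (koszulCover h2).betti_odd_succ i
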